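/- **Theorem 3.2.** Let $V$ be a real vector space of finite dimension $m\ge 4$ and let $\langle\cdot,\cdot\rangle$ be a non-degenerate symmetric bilinear form on $V$ (of arbitrary signature), with orthogonal group $O(V)=O(V,\langle\cdot,\cdot\rangle)$. The groups $GL(V)$ and $O(V)$ act naturally on $\otimes^kV^*$. For $R\in\otimes^4V^*$ consider the identities, for all $x,y,z,w\in V$: (a) $R(x,y,z,w)=-R(y,x,z,w)$; (b) $R(x,y,z,w)+R(y,z,x,w)+R(z,x,y,w)=0$; (c) $R(x,y,z,w)=R(z,w,x,y)$; (d) $R(x,y,z,w)=-R(x,y,w,z)$. Let $\mathfrak r(V)\subset\otimes^4V^*$ be the space of tensors satisfying (a) and (b), and $\mathfrak a(V)$ the space of tensors satisfying (a)–(d). View $\Lambda^2(V^*)\otimes S^2(V^*)$ as the space of $S\in\otimes^4V^*$ that are antisymmetric in the first two and symmetric in the last two arguments. For a basis $\{e_i\}$ let $(\Xi^{ij})$ be the inverse of the matrix $(\langle e_i,e_j\rangle)$, and put $$\tau(\psi)=\sum_{i,j}\Xi^{ij}\psi(e_i,e_j),\qquad \rho_{14}(R)(x,y)=\sum_{i,j}\Xi^{ij}R(e_i,x,y,e_j).$$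 Let $S^2_0(V^*)=\{\psi\in S^2(V^*):\tau(\psi)=0\}$ and $\mathfrak w(V)=\mathfrak a(V)\cap\ker\rho_{14}$. For $\phi,\psi\in S^2(V^*)$ let $$(\phi\wedge\psi)(x,y,z,w)=\tfrac12\{\phi(x,w)\psi(y,z)-\phi(x,z)\psi(y,w)+\phi(y,z)\psi(x,w)-\phi(y,w)\psi(x,z)\}.$$ Finally let $$(\mathrm{id}\otimes\pi_s)(R)(x,y,z,w)=\tfrac12\{R(x,y,z,w)+R(x,y,w,z)\},$$ $$\sigma_1(S)(x,y,z,w)=S(x,y,z,w)+\tfrac12\{S(z,y,x,w)+S(x,z,y,w)-S(w,y,x,z)-S(x,w,y,z)\},$$ $$\sigma_2(\psi)=\tfrac{2}{m-2}\,\psi\wedge\langle\cdot,\cdot\rangle-\tfrac{\tau(\psi)}{(m-1)(m-2)}\,\langle\cdot,\cdot\rangle\wedge\langle\cdot,\cdot\rangle .$$ 1. If $R\in\otimes^4V^*$ satisfies (a) and (b), then (c) and (d) are equivalent for $R$. 2. The map $\mathrm{id}\otimes\pi_s$ defines a short exact sequence of $GL(V)$-modules $$0\to\mathfrak a(V)\to\mathfrak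 r(V)\xrightarrow{\ \mathrm{id}\otimes\pi_s\ }\Lambda^2(V^*)\otimes S^2(V^*)\to0,$$ which is $GL(V)$-equivariantly split by $\sigma_1$, and $\rho_{14}$ defines a short exact sequence of $O(V)$-modules $$0\to\mathfrak w(V)\to\mathfrak a(V)\xrightarrow{\ \rho_{14}\ }S^2(V^*)\to0,$$ which is $O(V)$-equivariantly split by $\sigma_2$. 3. This gives an isomorphism of $O(V)$-modules $$\mathfrak w(V)\oplus S^2_0(V^*)\oplus\mathbb R\ \cong\ \mathfrak a(V),\qquad (W,\psi,c)\mapsto W+\sigma_2(\psi+c\langle\cdot,\cdot\rangle),$$ where $\mathbb R$ is the trivial module, and the three summands are irreducible $O(V)$-modules. Moreover $$\dim\mathfrak w(V)=\tfrac1{12}m(m+1)(m+2)(m-3),\quad \dim S^2_0(V^*)=\tfrac12(m-1)(m+2),$$ $$\dim\mathbb R=1,\quad \dim\mathfrak a(V)=\tfrac1{12}m^2(m^2-1).$$ -/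

import Mathlib

noncomputable section

namespace AlgCurv

/-! ### Tensors and the natural action of the general linear group -/

/-- `⊗²V*`: bilinear forms `ψ(x, y)`. -/
abbrev Tensor2 (V : Type*) [AddCommGroup V] [Module ℝ V] : Type _ :=
  V →ₗ[ℝ] V →ₗ[ℝ] ℝ

/-- `⊗⁴V*`: quadrilinear forms `R(x, y, z, w)`, in curried form. -/
abbrev Tensor4 (V : Type*) [AddCommGroup V] [Module ℝ V] : Type _ :=
  V →ₗ[ℝ] V →ₗ[ℝ] V →ₗ[ℝ] V →ₗ[ℝ] ℝ

/-! Shortcuts for instances that Mathlib's instance search finds only slowly. -/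

instance instGroup2 (V : Type*) [AddCommGroup V] [Module ℝ V] :
    AddCommGroup (V →ₗ[ℝ] V →ₗ[ℝ] ℝ) :=
  LinearMap.addCommGroup

instance instGroup3 (V : Type*) [AddCommGroup V] [Module ℝ V] :
    AddCommGroup (V →ₗ[ℝ] V →ₗ[ℝ] V →ₗ[ℝ] ℝ) :=
  LinearMap.addCommGroup

instance instGroup4 (V : Type*) [AddCommGroup V] [Module ℝ V] :
    AddCommGroup (V →ₗ[ℝ] V →ₗ[ℝ] V →ₗ[ℝ] V →ₗ[ℝ] ℝ) :=
  LinearMap.addCommGroup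

section Basics

variable {V : Type*} [AddCommGroup V] [Module ℝ V]

/-- A real function of four vectors that is linear in each of them, as an element of `⊗⁴V*`. -/
def Tensor4.of (f : V → V → V → V → ℝ)
    (a₁ : ∀ x x' y z w, f (x + x') y z w = f x y z w + f x' y z w)
    (s₁ : ∀ (c : ℝ) x y z w, f (c • x) y z w = c * f x y z w)
    (a₂ : ∀ x y y' z w, f x (y + y') z w = f x y z w + f x y' z w)
    (s₂ : ∀ (c : ℝ) x y z w, f x (c • y) z w = c * f x y z w)
    (a₃ : ∀ x y z z' w, f x y (z + z') w = f x y z w + f x y z' w)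
    (s₃ : ∀ (c : ℝ) x y z w, f x y (c • z) w = c * f x y z w)
    (a₄ : ∀ x y z w w', f x y z (w + w') = f x y z w + f x y z w')
    (s₄ : ∀ (c : ℝ) x y z w, f x y z (c • w) = c * f x y z w) : Tensor4 V :=
  LinearMap.mk₂ ℝ
    (fun x y => (LinearMap.mk₂ ℝ (f x y) (a₃ x y) (fun c z w => s₃ c x y z w)
      (a₄ x y) (fun c z w => s₄ c x y z w) : V →ₗ[ℝ] V →ₗ[ℝ] ℝ))
    (fun x x' y => by ext z w; simp [a₁]) (fun c x y => by ext z w; simp [s₁])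
    (fun x y y' => by ext z w; simp [a₂]) (fun c x y => by ext z w; simp [s₂])

/-- The defining representation of `GL(V)` on `V`. -/
def stdRep (V : Type*) [AddCommGroup V] [Module ℝ V] : Representation ℝ (V ≃ₗ[ℝ] V) V :=
  LinearEquiv.automorphismGroup.toLinearMapMonoidHom

/-- The natural representation of `GL(V)` on `⊗²V*`. -/
def rep2 (V : Type*) [AddCommGroup V] [Module ℝ V] : Representation ℝ (V ≃ₗ[ℝ] V) (Tensor2 V) :=
  (stdRep V).linHom ((stdRep V).linHom (Representation.trivial ℝ (V ≃ₗ[ℝ] V) ℝ))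

/-- The natural representation of `GL(V)` on `⊗⁴V*`. -/
def rep4 (V : Type*) [AddCommGroup V] [Module ℝ V] : Representation ℝ (V ≃ₗ[ℝ] V) (Tensor4 V) :=
  (stdRep V).linHom ((stdRep V).linHom (rep2 V))

theorem rep2_apply (g : V ≃ₗ[ℝ] V) (ψ : Tensor2 V) (x y : V) :
    rep2 V g ψ x y = ψ (g⁻¹ x) (g⁻¹ y) := rfl

theorem rep4_apply (g : V ≃ₗ[ℝ] V) (R : Tensor4 V) (x y z w : V) :
    rep4 V g R x y z w = R (g⁻¹ x) (g⁻¹ y) (g⁻¹ z) (g⁻¹ w) := rfl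

/-! ### Symmetries of quadrilinear forms -/

/-- `R(x,y,z,w) = -R(y,x,z,w)`. -/
def AntisymmFirst (R : Tensor4 V) : Prop :=
  ∀ x y z w, R x y z w = -R y x z w

/-- The first Bianchi identity. -/
def Bianchi (R : Tensor4 V) : Prop :=
  ∀ x y z w, R x y z w + R y z x w + R z x y w = 0

/-- `R(x,y,z,w) = R(z,w,x,y)`. -/
def PairSymm (R : Tensor4 V) : Prop :=
  ∀ x y z w, R x y z w = R z w x y

/-- `R(x,y,z,w) = -R(x,y,w,z)`. -/
def AntisymmLast (R : Tensor4 V) : Prop :=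
  ∀ x y z w, R x y z w = -R x y w z

/-- `R(x,y,z,w) = R(x,y,w,z)`. -/
def SymmLast (R : Tensor4 V) : Prop :=
  ∀ x y z w, R x y z w = R x y w z

/-! ### The `GL(V)`-modules `𝔯(V)`, `𝔞(V)`, `Λ²(V*) ⊗ S²(V*)`, `S²(V*)` -/

/-- `𝔯(V)`: antisymmetric in the first pair, with the first Bianchi identity. -/
def curv (V : Type*) [AddCommGroup V] [Module ℝ V] : Subrepresentation (rep4 V) where
  toSubmodule :=
    { carrier := {R | AntisymmFirst R ∧ Bianchi R}
      zero_mem' := by constructor <;> intro x y z w <;> simp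
      add_mem' := by
        rintro R R' ⟨h1, h2⟩ ⟨h1', h2'⟩
        refine ⟨fun x y z w => ?_, fun x y z w => ?_⟩ <;> simp only [LinearMap.add_apply]
        · linarith [h1 x y z w, h1' x y z w]
        · linarith [h2 x y z w, h2' x y z w]
      smul_mem' := by
        rintro c R ⟨h1, h2⟩
        refine ⟨fun x y z w => ?_, fun x y z w => ?_⟩ <;>
          simp only [LinearMap.smul_apply, smul_eq_mul]
        · linear_combination c * h1 x y z w
        · linear_combination c * h2 x y z w }
  apply_mem_toSubmodule g R h := ⟨fun _ _ _ _ => h.1 _ _ _ _, fun _ _ _ _ => h.2 _ _ _ _⟩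

/-- `𝔞(V)`: the algebraic curvature tensors. -/
def algCurv (V : Type*) [AddCommGroup V] [Module ℝ V] : Subrepresentation (rep4 V) where
  toSubmodule :=
    { carrier := {A | AntisymmFirst A ∧ Bianchi A ∧ PairSymm A ∧ AntisymmLast A}
      zero_mem' := by refine ⟨?_, ?_, ?_, ?_⟩ <;> intro x y z w <;> simp
      add_mem' := by
        rintro R R' ⟨h1, h2, h3, h4⟩ ⟨h1', h2', h3', h4'⟩
        refine ⟨fun x y z w => ?_, fun x y z w => ?_, fun x y z w => ?_, fun x y z w => ?_⟩ <;>
          simp only [LinearMap.add_apply]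
        · linarith [h1 x y z w, h1' x y z w]
        · linarith [h2 x y z w, h2' x y z w]
        · linarith [h3 x y z w, h3' x y z w]
        · linarith [h4 x y z w, h4' x y z w]
      smul_mem' := by
        rintro c R ⟨h1, h2, h3, h4⟩
        refine ⟨fun x y z w => ?_, fun x y z w => ?_, fun x y z w => ?_, fun x y z w => ?_⟩ <;>
          simp only [LinearMap.smul_apply, smul_eq_mul]
        · linear_combination c * h1 x y z w
        · linear_combination c * h2 x y z w
        · linear_combination c * h3 x y z w
        · linear_combination c * h4 x y z w }
  apply_mem_toSubmodule g R h :=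
    ⟨fun _ _ _ _ => h.1 _ _ _ _, fun _ _ _ _ => h.2.1 _ _ _ _,
      fun _ _ _ _ => h.2.2.1 _ _ _ _, fun _ _ _ _ => h.2.2.2 _ _ _ _⟩

/-- `Λ²(V*) ⊗ S²(V*)` as a submodule of `⊗⁴V*`: the forms that are antisymmetric in the first pair
and symmetric in the last pair (see `altSym_eq_span`). -/
def altSym (V : Type*) [AddCommGroup V] [Module ℝ V] : Subrepresentation (rep4 V) where
  toSubmodule :=
    { carrier := {S | AntisymmFirst S ∧ SymmLast S}
      zero_mem' := by constructor <;> intro x y z w <;> simp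
      add_mem' := by
        rintro R R' ⟨h1, h2⟩ ⟨h1', h2'⟩
        refine ⟨fun x y z w => ?_, fun x y z w => ?_⟩ <;> simp only [LinearMap.add_apply]
        · linarith [h1 x y z w, h1' x y z w]
        · linarith [h2 x y z w, h2' x y z w]
      smul_mem' := by
        rintro c R ⟨h1, h2⟩
        refine ⟨fun x y z w => ?_, fun x y z w => ?_⟩ <;>
          simp only [LinearMap.smul_apply, smul_eq_mul]
        · linear_combination c * h1 x y z w
        · linear_combination c * h2 x y z w }
  apply_mem_toSubmodule g R h := ⟨fun _ _ _ _ => h.1 _ _ _ _, fun _ _ _ _ => h.2 _ _ _ _⟩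

/-- `S²(V*)`: the symmetric bilinear forms. -/
def sym2 (V : Type*) [AddCommGroup V] [Module ℝ V] : Subrepresentation (rep2 V) where
  toSubmodule :=
    { carrier := {ψ | ∀ x y, ψ x y = ψ y x}
      zero_mem' := by intro x y; simp
      add_mem' := by
        intro ψ ψ' h h' x y
        simp only [LinearMap.add_apply]
        linarith [h x y, h' x y]
      smul_mem' := by
        intro c ψ h x y
        simp only [LinearMap.smul_apply, smul_eq_mul]
        linear_combination c * h x y }
  apply_mem_toSubmodule g ψ h := fun _ _ => h _ _

/-- The product `(ω ⊗ ψ)(x,y,z,w) = ω(x,y) ψ(z,w)`. -/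
def tprod (ω ψ : Tensor2 V) : Tensor4 V :=
  Tensor4.of (fun x y z w => ω x y * ψ z w)
    (by intros; simp; ring) (by intros; simp; ring) (by intros; simp; ring) (by intros; simp; ring)
    (by intros; simp; ring) (by intros; simp; ring) (by intros; simp; ring) (by intros; simp; ring)

/-- `altSym V` is spanned by the products of antisymmetric and symmetric bilinear forms. -/
theorem altSym_eq_span [FiniteDimensional ℝ V] :
    (altSym V).toSubmodule =
      Submodule.span ℝ {S | ∃ ω ψ : Tensor2 V, (∀ x y, ω x y = -ω y x) ∧ (∀ x y, ψ x y = ψ y x) ∧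
        S = tprod ω ψ} := by
  apply le_antisymm
  · intro S hS
    let b := Module.finBasis ℝ V
    let ω : Fin (Module.finrank ℝ V) → Fin (Module.finrank ℝ V) → Tensor2 V := fun k l =>
      LinearMap.mk₂ ℝ (fun x y => S x y (b k) (b l)) (by intros; simp) (by intros; simp)
        (by intros; simp) (by intros; simp)
    let ε : Fin (Module.finrank ℝ V) → Fin (Module.finrank ℝ V) → Tensor2 V := fun k l =>
      LinearMap.mk₂ ℝ (fun z w => (1 / 2 : ℝ) * (b.repr z k * b.repr w l + b.repr z l * b.repr w k))
        (by intros; simp; ring) (by intros; simp; ring)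
        (by intros; simp; ring) (by intros; simp; ring)
    have key : S = ∑ k, ∑ l, tprod (ω k l) (ε k l) := by
      ext x y z w
      have h1 : S x y z w = ∑ k, ∑ l, S x y (b k) (b l) * (b.repr z k * b.repr w l) := by
        conv_lhs => rw [← b.sum_repr z, ← b.sum_repr w]
        simp only [map_sum, map_smul, LinearMap.sum_apply, LinearMap.smul_apply, smul_eq_mul,
          Finset.mul_sum]
        rw [Finset.sum_comm]
        refine Finset.sum_congr rfl fun k _ => Finset.sum_congr rfl fun l _ => ?_
        ring
      have h2 : S x y z w = ∑ k, ∑ l, S x y (b k) (b l) * (b.repr z l * b.repr w k) := by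
        rw [h1, Finset.sum_comm]
        refine Finset.sum_congr rfl fun k _ => Finset.sum_congr rfl fun l _ => ?_
        rw [hS.2 x y (b l) (b k)]
      have h3 : (∑ k, ∑ l, tprod (ω k l) (ε k l)) x y z w =
          ∑ k, ∑ l, S x y (b k) (b l) *
            ((1 / 2 : ℝ) * (b.repr z k * b.repr w l + b.repr z l * b.repr w k)) := by
        simp only [LinearMap.sum_apply]
        rfl
      have h4 : S x y z w = (1 / 2 : ℝ) * S x y z w + (1 / 2 : ℝ) * S x y z w := by ring
      rw [h3, h4]
      nth_rewrite 1 [h1]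
      rw [h2]
      simp only [Finset.mul_sum, ← Finset.sum_add_distrib]
      refine Finset.sum_congr rfl fun k _ => Finset.sum_congr rfl fun l _ => ?_
      ring
    rw [key]
    refine Submodule.sum_mem _ fun k _ => Submodule.sum_mem _ fun l _ =>
      Submodule.subset_span ⟨ω k l, ε k l, fun x y => hS.1 _ _ _ _, fun z w => ?_, rfl⟩
    simp only [ε, LinearMap.mk₂_apply]
    ring
  · rw [Submodule.span_le]
    rintro _ ⟨ω, ψ, hω, hψ, rfl⟩
    refine ⟨fun x y z w => ?_, fun x y z w => ?_⟩
    · change ω x y * ψ z w = -(ω y x * ψ z w)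
      rw [hω x y]; ring
    · change ω x y * ψ z w = ω x y * ψ w z
      rw [hψ z w]

/-! ### The maps `id ⊗ π_s` and its splitting -/

/-- `(id ⊗ π_s)(R)(x,y,z,w) = ½ (R(x,y,z,w) + R(x,y,w,z))`. -/
def idSym (R : Tensor4 V) : Tensor4 V :=
  Tensor4.of (fun x y z w => (1 / 2 : ℝ) * (R x y z w + R x y w z))
    (by intros; simp; ring) (by intros; simp; ring) (by intros; simp; ring) (by intros; simp; ring)
    (by intros; simp; ring) (by intros; simp; ring) (by intros; simp; ring) (by intros; simp; ring)

/-- `σ(S)(x,y,z,w) = S(x,y,z,w) + ½ (S(z,y,x,w) + S(x,z,y,w) - S(w,y,x,z) - S(x,w,y,z))`. -/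
def idSymSplit (S : Tensor4 V) : Tensor4 V :=
  Tensor4.of
    (fun x y z w => S x y z w + (1 / 2 : ℝ) * (S z y x w + S x z y w - S w y x z - S x w y z))
    (by intros; simp; ring) (by intros; simp; ring) (by intros; simp; ring) (by intros; simp; ring)
    (by intros; simp; ring) (by intros; simp; ring) (by intros; simp; ring) (by intros; simp; ring)

/-- The product `φ ∧ ψ` of bilinear forms, with the factor `½`. -/
def wedge (φ ψ : Tensor2 V) : Tensor4 V :=
  Tensor4.of
    (fun x y z w => (1 / 2 : ℝ) * (φ x w * ψ y z - φ x z * ψ y w + φ y z * ψ x w - φ y w * ψ x z))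
    (by intros; simp; ring) (by intros; simp; ring) (by intros; simp; ring) (by intros; simp; ring)
    (by intros; simp; ring) (by intros; simp; ring) (by intros; simp; ring) (by intros; simp; ring)

theorem idSym_apply (R : Tensor4 V) (x y z w : V) :
    idSym R x y z w = (1 / 2 : ℝ) * (R x y z w + R x y w z) := rfl

theorem idSymSplit_apply (S : Tensor4 V) (x y z w : V) :
    idSymSplit S x y z w =
      S x y z w + (1 / 2 : ℝ) * (S z y x w + S x z y w - S w y x z - S x w y z) := rfl

theorem wedge_apply (φ ψ : Tensor2 V) (x y z w : V) :
    wedge φ ψ x y z w =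
      (1 / 2 : ℝ) * (φ x w * ψ y z - φ x z * ψ y w + φ y z * ψ x w - φ y w * ψ x z) := rfl

end Basics

/-! ### Traces with respect to a non-degenerate form, and the orthogonal group -/

section Metric

variable {V : Type*} [AddCommGroup V] [Module ℝ V]

/-- The orthogonal group `O(V, B)` of a bilinear form `B`. -/
def orthogonalGroup (B : LinearMap.BilinForm ℝ V) : Subgroup (V ≃ₗ[ℝ] V) where
  carrier := {g | ∀ x y, B (g x) (g y) = B x y}
  one_mem' := fun _ _ => rfl
  mul_mem' := fun {g h} hg hh x y => (hg (h x) (h y)).trans (hh x y)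
  inv_mem' := fun {g} hg x y => by
    have h := hg (g⁻¹ x) (g⁻¹ y)
    have e : ∀ v, g (g⁻¹ v) = v := fun v => g.apply_symm_apply v
    rw [e, e] at h
    exact h.symm

/-- The natural representation of `O(V, B)` on `⊗²V*`. -/
def orep2 (B : LinearMap.BilinForm ℝ V) : Representation ℝ (orthogonalGroup B) (Tensor2 V) :=
  (rep2 V).comp (orthogonalGroup B).subtype

/-- The natural representation of `O(V, B)` on `⊗⁴V*`. -/
def orep4 (B : LinearMap.BilinForm ℝ V) : Representation ℝ (orthogonalGroup B) (Tensor4 V) :=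
  (rep4 V).comp (orthogonalGroup B).subtype

variable [FiniteDimensional ℝ V]

/-- `τ(ψ)`: the trace of the endomorphism `E` of `V` with `B (E x) y = ψ x y`, that is
`∑ᵢⱼ Ξⁱʲ ψ(eᵢ, eⱼ)` with `(Ξⁱʲ)` the inverse of the Gram matrix of `B` in any basis
(see `metricTrace_eq_sum`). -/
def metricTrace (B : LinearMap.BilinForm ℝ V) (hB : B.Nondegenerate) : Tensor2 V →ₗ[ℝ] ℝ where
  toFun ψ := LinearMap.trace ℝ V ((B.toDual hB).symm.toLinearMap ∘ₗ ψ)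
  map_add' ψ ψ' := by rw [LinearMap.comp_add, map_add]
  map_smul' c ψ := by rw [LinearMap.comp_smul, map_smul]; rfl

/-- `ρ₁₄(R)(y,z) = ∑ᵢⱼ Ξⁱʲ R(eᵢ, y, z, eⱼ)`: the trace of `R` in its first and last arguments. -/
def rho14 (B : LinearMap.BilinForm ℝ V) (hB : B.Nondegenerate) : Tensor4 V →ₗ[ℝ] Tensor2 V where
  toFun R := LinearMap.mk₂ ℝ (fun y z => metricTrace B hB ((R.flip y).flip z))
    (fun y y' z => by
      rw [← map_add]; congr 1; ext; simp)
    (fun c y z => by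
      rw [← map_smul]; congr 1; ext; simp)
    (fun y z z' => by
      rw [← map_add]; congr 1; ext; simp)
    (fun c y z => by
      rw [← map_smul]; congr 1; ext; simp)
  map_add' R R' := by
    ext y z
    simp only [LinearMap.mk₂_apply, LinearMap.add_apply]
    rw [← map_add]; congr 1
  map_smul' c R := by
    ext y z
    simp only [LinearMap.mk₂_apply, LinearMap.smul_apply, RingHom.id_apply]
    rw [← map_smul]; congr 1

theorem metricTrace_eq_sum {ι : Type*} [Fintype ι] [DecidableEq ι] (b : Module.Basis ι ℝ V)
    (B : LinearMap.BilinForm ℝ V) (hB : B.Nondegenerate) (hsymm : B.IsSymm) (ψ : Tensor2 V) :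
    metricTrace B hB ψ =
      ∑ i, ∑ j, (Matrix.of fun i j => B (b i) (b j))⁻¹ i j * ψ (b i) (b j) := by
  set E : V →ₗ[ℝ] V := (B.toDual hB).symm.toLinearMap ∘ₗ ψ with hE
  set G : Matrix ι ι ℝ := Matrix.of fun i j => B (b i) (b j) with hG
  have hEψ : ∀ x y, B (E x) y = ψ x y := fun x y =>
    LinearMap.BilinForm.apply_toDual_symm_apply (hB := hB) (ψ x) y
  have hdet : IsUnit G.det := by
    have : G = LinearMap.BilinForm.toMatrix b B := by
      ext i j; simp [hG, LinearMap.BilinForm.toMatrix_apply]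
    rw [this]
    exact isUnit_iff_ne_zero.mpr ((LinearMap.BilinForm.nondegenerate_iff_det_ne_zero b).mp hB)
  have hsym : G.transpose = G := by
    ext i j
    exact hsymm.eq (b j) (b i)
  have hΨ : (Matrix.of fun i j => ψ (b i) (b j)) = (LinearMap.toMatrix b b E).transpose * G := by
    ext i j
    rw [Matrix.of_apply, ← hEψ]
    conv_lhs => rw [← b.sum_repr (E (b i))]
    simp only [map_sum, map_smul, LinearMap.sum_apply, LinearMap.smul_apply, smul_eq_mul]
    rw [Matrix.mul_apply]
    refine Finset.sum_congr rfl fun k _ => ?_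
    rw [Matrix.transpose_apply, LinearMap.toMatrix_apply, hG, Matrix.of_apply]
  have h1 : (LinearMap.toMatrix b b E).transpose =
      (Matrix.of fun i j => ψ (b i) (b j)) * G⁻¹ := by
    rw [hΨ, Matrix.mul_assoc, Matrix.mul_nonsing_inv _ hdet, Matrix.mul_one]
  change LinearMap.trace ℝ V E = _
  rw [LinearMap.trace_eq_matrix_trace ℝ b E, ← Matrix.trace_transpose, h1, Matrix.trace]
  refine Finset.sum_congr rfl fun i _ => ?_
  rw [Matrix.diag_apply, Matrix.mul_apply]
  refine Finset.sum_congr rfl fun j _ => ?_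
  have : G⁻¹ j i = G⁻¹ i j := by
    have h := congrFun (congrFun (Matrix.transpose_nonsing_inv G) i) j
    rw [hsym] at h
    exact h
  rw [this, Matrix.of_apply, mul_comm]

theorem rho14_eq_sum {ι : Type*} [Fintype ι] [DecidableEq ι] (b : Module.Basis ι ℝ V)
    (B : LinearMap.BilinForm ℝ V) (hB : B.Nondegenerate) (hsymm : B.IsSymm) (R : Tensor4 V)
    (y z : V) :
    rho14 B hB R y z =
      ∑ i, ∑ j, (Matrix.of fun i j => B (b i) (b j))⁻¹ i j * R (b i) y z (b j) :=
  metricTrace_eq_sum b B hB hsymm ((R.flip y).flip z)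

theorem metricTrace_orep2 (B : LinearMap.BilinForm ℝ V) (hB : B.Nondegenerate)
    (g : orthogonalGroup B) (ψ : Tensor2 V) :
    metricTrace B hB (orep2 B g ψ) = metricTrace B hB ψ := by
  have key : (B.toDual hB).symm.toLinearMap ∘ₗ (orep2 B g ψ) =
      (g : V ≃ₗ[ℝ] V).conj ((B.toDual hB).symm.toLinearMap ∘ₗ ψ) := by
    ext x
    apply (B.toDual hB).injective
    ext y
    have e : (g : V ≃ₗ[ℝ] V) ((g : V ≃ₗ[ℝ] V)⁻¹ y) = y := (g : V ≃ₗ[ℝ] V).apply_symm_apply y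
    rw [LinearMap.BilinForm.toDual_def, LinearMap.BilinForm.toDual_def]
    have l : B (((B.toDual hB).symm.toLinearMap ∘ₗ (orep2 B g ψ)) x) y = orep2 B g ψ x y :=
      LinearMap.BilinForm.apply_toDual_symm_apply (hB := hB) (orep2 B g ψ x) y
    rw [l]
    conv_rhs => rw [← e]
    rw [LinearEquiv.conj_apply_apply]
    refine Eq.trans ?_ (g.2 _ _).symm
    exact (LinearMap.BilinForm.apply_toDual_symm_apply (hB := hB)
      (ψ ((g : V ≃ₗ[ℝ] V)⁻¹ x)) ((g : V ≃ₗ[ℝ] V)⁻¹ y)).symm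
  change LinearMap.trace ℝ V _ = LinearMap.trace ℝ V _
  rw [key, LinearMap.trace_conj']

theorem rho14_orep4 (B : LinearMap.BilinForm ℝ V) (hB : B.Nondegenerate)
    (g : orthogonalGroup B) (R : Tensor4 V) :
    rho14 B hB (orep4 B g R) = orep2 B g (rho14 B hB R) := by
  ext y z
  exact metricTrace_orep2 B hB g
    ((R.flip ((g : V ≃ₗ[ℝ] V)⁻¹ y)).flip ((g : V ≃ₗ[ℝ] V)⁻¹ z))

/-! ### The `O(V, B)`-modules `𝔞(V)`, `S²(V*)`, `𝔴(V, B)`, `S₀²(V*, B)` -/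

/-- `𝔞(V)` as an `O(V, B)`-module. -/
def oAlgCurv (B : LinearMap.BilinForm ℝ V) : Subrepresentation (orep4 B) where
  toSubmodule := (algCurv V).toSubmodule
  apply_mem_toSubmodule g _ h := (algCurv V).apply_mem_toSubmodule (g : V ≃ₗ[ℝ] V) h

/-- `S²(V*)` as an `O(V, B)`-module. -/
def oSym2 (B : LinearMap.BilinForm ℝ V) : Subrepresentation (orep2 B) where
  toSubmodule := (sym2 V).toSubmodule
  apply_mem_toSubmodule g _ h := (sym2 V).apply_mem_toSubmodule (g : V ≃ₗ[ℝ] V) h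

/-- `𝔴(V, B) = ker ρ₁₄ ∩ 𝔞(V)`: the Weyl conformal curvature tensors. -/
def weyl (B : LinearMap.BilinForm ℝ V) (hB : B.Nondegenerate) : Subrepresentation (orep4 B) where
  toSubmodule := LinearMap.ker (rho14 B hB) ⊓ (algCurv V).toSubmodule
  apply_mem_toSubmodule g R h := by
    refine ⟨?_, (oAlgCurv B).apply_mem_toSubmodule g h.2⟩
    have h1 : rho14 B hB R = 0 := h.1
    change rho14 B hB (orep4 B g R) = 0
    rw [rho14_orep4, h1, map_zero]

/-- `S₀²(V*, B)`: the symmetric bilinear forms with `τ(ψ) = 0`. -/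
def sym2Zero (B : LinearMap.BilinForm ℝ V) (hB : B.Nondegenerate) :
    Subrepresentation (orep2 B) where
  toSubmodule := LinearMap.ker (metricTrace B hB) ⊓ (sym2 V).toSubmodule
  apply_mem_toSubmodule g ψ h := by
    refine ⟨?_, (oSym2 B).apply_mem_toSubmodule g h.2⟩
    have h1 : metricTrace B hB ψ = 0 := h.1
    change metricTrace B hB (orep2 B g ψ) = 0
    rw [metricTrace_orep2, h1]

/-- `σ(ψ) = 2/(m-2) ψ ∧ B - τ(ψ)/((m-1)(m-2)) B ∧ B`, where `m = dim V`. -/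
def rho14Split (B : LinearMap.BilinForm ℝ V) (hB : B.Nondegenerate) (ψ : Tensor2 V) : Tensor4 V :=
  (2 / ((Module.finrank ℝ V : ℝ) - 2)) • wedge ψ B -
    (metricTrace B hB ψ / (((Module.finrank ℝ V : ℝ) - 1) * ((Module.finrank ℝ V : ℝ) - 2))) •
      wedge B B

end Metric

/-! ### Equivariantly split short exact sequences -/

/-- `0 → X → Y → Z → 0` (maps `i`, `p`) is a short exact sequence of representations of `G`,
split by the equivariant map `s : Z → Y`. -/
structure IsSplitShortExact {G X Y Z : Type*} [Group G]
    [AddCommGroup X] [Module ℝ X] [AddCommGroup Y] [Module ℝ Y] [AddCommGroup Z] [Module ℝ Z]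
    {ρX : Representation ℝ G X} {ρY : Representation ℝ G Y} {ρZ : Representation ℝ G Z}
    (i : ρX.IntertwiningMap ρY) (p : ρY.IntertwiningMap ρZ) (s : ρZ.IntertwiningMap ρY) :
    Prop where
  injective : Function.Injective i
  exact : Function.Exact i p
  surjective : Function.Surjective p
  split : ∀ v, p (s v) = v

end AlgCurv

end

/-!
The sequence of `GL(V)`-modules is checked by direct computation with the symmetries. For the second
sequence, `ρ₁₄ (ψ ∧ B) = (τ(ψ) B + (m - 2) ψ) / 2`, which gives the splitting `σ₂`, and
`S²(V*) = S₀²(V*) ⊕ ℝ B` then decomposes `𝔞(V)`.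

The spaces `𝔯(V)`, `Λ²(V*) ⊗ S²(V*)` and `S²(V*)` are images of projectors that are combinations of
permutations of the arguments. The trace of such a permutation on `⊗ᵏV*` is `m` to the number of its
cycles, and this yields all the dimensions.

For irreducibility, the metric induces an invariant form on `⊗ᵏV*`, and a module with an invariant
form is irreducible as soon as every nonzero submodule contains one fixed non-isotropic vector `t`:
otherwise `t` would lie in a submodule and in its orthogonal complement. For `S₀²(V*)` take
`t = ξ⁰ξ¹`, for `𝔴(V)` take `t = (ξ⁰ξ¹) ∧ (ξ²ξ³)`, in the coordinates of an orthogonal basis. Let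
`N` be a nonzero submodule. Sign changes of basis vectors project `N` onto the components that
involve prescribed indices an odd number of times, and reflections mixing two basis vectors permute
the indices. So `N` contains a nonzero multiple of `t` once some tensor in `N` has a component with
distinct indices that does not vanish; and if all of them vanished, the invariance under these
reflections would make the diagonal components proportional to those of `B`, hence zero because the
traces vanish.
-/

noncomputable section

namespace AlgCurv

/-! ### Representations and split exact sequences -/

section Representations

variable {k G X Y : Type*} [Field k] [Group G] [AddCommGroup X] [Module k X] [AddCommGroup Y]
  [Module k Y] {ρ : Representation k G X} {σ : Representation k G Y}

/-- The inclusion of nested subrepresentations as an equivariant map. -/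
def inclusionIntertwining {U W : Subrepresentation ρ} (h : U.toSubmodule ≤ W.toSubmodule) :
    U.toRepresentation.IntertwiningMap W.toRepresentation where
  toLinearMap := Submodule.inclusion h
  isIntertwining' _ := rfl

/-- An equivariant linear map that carries a subrepresentation into another one, as an equivariant
map between these. -/
def restrictIntertwining {U : Subrepresentation ρ} {W : Subrepresentation σ} (f : X →ₗ[k] Y)
    (hf : ∀ g v, f (ρ g v) = σ g (f v)) (hUW : ∀ v ∈ U.toSubmodule, f v ∈ W.toSubmodule) :
    U.toRepresentation.IntertwiningMap W.toRepresentation :=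
  LinearMap.intertwiningMap_of_isIntertwiningMap _ _ (f.restrict hUW) fun g v =>
    Subtype.ext (hf g v)

/-- The orthogonal complement of a subrepresentation with respect to an invariant bilinear form. -/
def orthogonalSubrep (b : LinearMap.BilinForm k X) (hb : ∀ g x y, b (ρ g x) (ρ g y) = b x y)
    (M : Subrepresentation ρ) : Subrepresentation ρ where
  toSubmodule := b.orthogonal M.toSubmodule
  apply_mem_toSubmodule g v hv m hm := by
    have h := hb g (ρ g⁻¹ m) v
    rw [ρ.self_inv_apply] at h
    exact h.trans (hv _ (M.apply_mem_toSubmodule g⁻¹ hm))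

theorem isIrreducible_of_forall_mem [FiniteDimensional k X] (b : LinearMap.BilinForm k X)
    (hb : ∀ g x y, b (ρ g x) (ρ g y) = b x y) (t : X) (ht : b t t ≠ 0)
    (h : ∀ M : Subrepresentation ρ, M.toSubmodule ≠ ⊥ → t ∈ M.toSubmodule) :
    ρ.IsIrreducible := by
  have ht0 : t ≠ 0 := by
    rintro rfl
    simp at ht
  have bot_ne_top : (⊥ : Subrepresentation ρ) ≠ ⊤ := fun e =>
    ht0 ((Submodule.mem_bot k).1 (e ▸ Submodule.mem_top : t ∈ (⊥ : Subrepresentation ρ)))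
  refine { exists_pair_ne := ⟨⊥, ⊤, bot_ne_top⟩, eq_bot_or_eq_top := fun M => ?_ }
  by_contra! hM
  have hM_bot : M.toSubmodule ≠ ⊥ := fun e => hM.1 (Subrepresentation.toSubmodule_injective e)
  have orth_ne_bot : (orthogonalSubrep b hb M).toSubmodule ≠ ⊥ := fun e => by
    have hsum := b.finrank_add_finrank_orthogonal' M.toSubmodule
    rw [show b.orthogonal M.toSubmodule = ⊥ from e, finrank_bot] at hsum
    refine hM.2 (Subrepresentation.toSubmodule_injective
      (Submodule.eq_top_of_finrank_eq (le_antisymm (Submodule.finrank_le _) ?_)))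
    omega
  exact ht (h _ orth_ne_bot t (h M hM_bot))

theorem isIrreducible_toRepresentation_of_forall_mem [FiniteDimensional k X]
    (b : LinearMap.BilinForm k X) (hb : ∀ g x y, b (ρ g x) (ρ g y) = b x y)
    (W : Subrepresentation ρ) (t : X) (ht : b t t ≠ 0) (htW : t ∈ W.toSubmodule)
    (h : ∀ N : Subrepresentation ρ, N.toSubmodule ≤ W.toSubmodule → N.toSubmodule ≠ ⊥ →
      t ∈ N.toSubmodule) :
    W.toRepresentation.IsIrreducible := by
  refine isIrreducible_of_forall_mem (b.restrict W.toSubmodule) (fun g x y => hb g x y) ⟨t, htW⟩ ht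
    fun M hM => ?_
  let N : Subrepresentation ρ :=
    { toSubmodule := M.toSubmodule.map W.toSubmodule.subtype
      apply_mem_toSubmodule := by
        rintro g _ ⟨x, hx, rfl⟩
        exact ⟨_, M.apply_mem_toSubmodule g hx, rfl⟩ }
  have hN : N.toSubmodule ≠ ⊥ := fun e =>
    hM <|
    Submodule.map_injective_of_injective W.toSubmodule.subtype_injective
      (e.trans (Submodule.map_bot _).symm)
  obtain ⟨x, hx, hxt⟩ := h N (Submodule.map_subtype_le _ _) hN
  exact (Subtype.ext hxt : x = ⟨t, htW⟩) ▸ hx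

theorem isIrreducible_of_finrank_eq_one (hX : Module.finrank k X = 1) : ρ.IsIrreducible := by
  have := isSimpleModule_iff_finrank_eq_one.2 hX
  have bot_ne_top : (⊥ : Subrepresentation ρ) ≠ ⊤ := fun e =>
    bot_ne_top (α := Submodule k X) (congrArg Subrepresentation.toSubmodule e)
  exact
    { exists_pair_ne := ⟨⊥, ⊤, bot_ne_top⟩
      eq_bot_or_eq_top := fun M => (eq_bot_or_eq_top M.toSubmodule).imp
        (fun e => Subrepresentation.toSubmodule_injective e)
        fun e => Subrepresentation.toSubmodule_injective e }

end Representations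

namespace IsSplitShortExact

variable {G X Y Z : Type*} [Group G] [AddCommGroup X] [Module ℝ X] [AddCommGroup Y] [Module ℝ Y]
  [AddCommGroup Z] [Module ℝ Z] {ρX : Representation ℝ G X} {ρY : Representation ℝ G Y}
  {ρZ : Representation ℝ G Z}

theorem of_inclusion {U W : Subrepresentation ρX} (h : U.toSubmodule ≤ W.toSubmodule)
    {p : W.toRepresentation.IntertwiningMap ρZ} {s : ρZ.IntertwiningMap W.toRepresentation}
    (hker : ∀ v : W.toSubmodule, p v = 0 ↔ (v : X) ∈ U.toSubmodule) (hps : ∀ z, p (s z) = z) :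
    IsSplitShortExact (inclusionIntertwining h) p s where
  injective := Submodule.inclusion_injective h
  exact v := (hker v).trans ⟨fun hv => ⟨⟨v, hv⟩, rfl⟩, by rintro ⟨u, rfl⟩; exact u.2⟩
  surjective z := ⟨s z, hps z⟩
  split := hps

variable {i : ρX.IntertwiningMap ρY} {p : ρY.IntertwiningMap ρZ} {s : ρZ.IntertwiningMap ρY}

/-- The isomorphism `X × Z ≃ Y`, `(x, z) ↦ i x + s z`, of a split short exact sequence. -/
def prodEquiv (h : IsSplitShortExact i p s) : (ρX.prod ρZ).Equiv ρY :=
  .mk (LinearEquiv.ofBijective (i.toLinearMap.coprod s.toLinearMap) <| by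
    have p_apply : ∀ x z, p (i x + s z) = z := fun x z => by
      rw [map_add, h.exact.apply_apply_eq_zero, zero_add, h.split]
    refine ⟨fun ⟨x, z⟩ ⟨x', z'⟩ e => ?_, fun y => ?_⟩
    · change i x + s z = i x' + s z' at e
      obtain rfl : z = z' := by rw [← p_apply x z, e, p_apply]
      rw [h.injective (add_right_cancel e)]
    · obtain ⟨x, hx⟩ := (h.exact (y - s (p y))).1 (by rw [map_sub, h.split, sub_self])
      exact ⟨(x, p y), (congrArg (· + s (p y)) hx).trans (sub_add_cancel y _)⟩)
  fun g => LinearMap.ext fun ⟨x, z⟩ => by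
    change i (ρX g x) + s (ρZ g z) = ρY g (i x + s z)
    rw [map_add, i.isIntertwining, s.isIntertwining]

theorem finrank_eq_add [FiniteDimensional ℝ Y] (h : IsSplitShortExact i p s) :
    Module.finrank ℝ Y = Module.finrank ℝ X + Module.finrank ℝ Z := by
  have := Module.Finite.of_injective i.toLinearMap h.injective
  have := Module.Finite.of_surjective p.toLinearMap h.surjective
  rw [← h.prodEquiv.toLinearEquiv.finrank_eq, Module.finrank_prod]

end IsSplitShortExact

/-- The product of two isomorphisms of representations. -/
def prodCongrEquiv {G X X' Y Y' : Type*} [Group G] [AddCommGroup X] [Module ℝ X]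
    [AddCommGroup X'] [Module ℝ X'] [AddCommGroup Y] [Module ℝ Y] [AddCommGroup Y'] [Module ℝ Y']
    {ρX : Representation ℝ G X} {ρX' : Representation ℝ G X'} {ρY : Representation ℝ G Y}
    {ρY' : Representation ℝ G Y'} (e : ρX.Equiv ρX') (f : ρY.Equiv ρY') :
    (ρX.prod ρY).Equiv (ρX'.prod ρY') :=
  .mk (e.toLinearEquiv.prodCongr f.toLinearEquiv) fun g => LinearMap.ext fun v =>
    Prod.ext (e.toIntertwiningMap.isIntertwining ρX ρX' g v.1)
      (f.toIntertwiningMap.isIntertwining ρY ρY' g v.2)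

/-! ### The sequence of `GL(V)`-modules -/

section GeneralLinear

variable {V : Type*} [AddCommGroup V] [Module ℝ V]

theorem Tensor4.ext4 {R S : Tensor4 V} (h : ∀ x y z w, R x y z w = S x y z w) : R = S := by
  ext x y z w
  exact h x y z w

theorem Tensor4.congr_apply {R S : Tensor4 V} (h : R = S) (x y z w : V) :
    R x y z w = S x y z w := by rw [h]

theorem antisymmLast_of_pairSymm {R : Tensor4 V} (ha : AntisymmFirst R) (hc : PairSymm R) :
    AntisymmLast R := fun x y z w => by
  rw [hc x y z w, ha z w x y, hc w z x y]

theorem pairSymm_of_antisymmLast {R : Tensor4 V} (ha : AntisymmFirst R) (hb : Bianchi R)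
    (hd : AntisymmLast R) : PairSymm R := fun x y z w => by
  have swap_both : ∀ a b c d, R b a d c = R a b c d := fun a b c d => by
    rw [ha, hd, neg_neg]
  -- In the sum of two cyclically consecutive Bianchi identities a pair of terms cancels by `hd`.
  have first_two_cycles : R x y z w - R z w x y + R z x y w + R w y z x = 0 := by
    linarith [hb x y z w, hb y z w x, hd y z x w, hd z w x y]
  have last_two_cycles : R z w x y - R x y z w + R x z w y + R y w x z = 0 := by
    linarith [hb z w x y, hb w x y z, hd w x z y, hd x y z w]
  linarith [swap_both z x y w, swap_both w y z x]

theorem pairSymm_iff_antisymmLast {R : Tensor4 V} (ha : AntisymmFirst R) (hb : Bianchi R) :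
    PairSymm R ↔ AntisymmLast R :=
  ⟨antisymmLast_of_pairSymm ha, pairSymm_of_antisymmLast ha hb⟩

theorem mem_algCurv_of_antisymmLast {R : Tensor4 V} (ha : AntisymmFirst R) (hb : Bianchi R)
    (hd : AntisymmLast R) : R ∈ (algCurv V).toSubmodule :=
  ⟨ha, hb, pairSymm_of_antisymmLast ha hb hd, hd⟩

theorem algCurv_le_curv : (algCurv V).toSubmodule ≤ (curv V).toSubmodule :=
  fun _ hR => ⟨hR.1, hR.2.1⟩

theorem idSym_mem_altSym {R : Tensor4 V} (hR : AntisymmFirst R) :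
    idSym R ∈ (altSym V).toSubmodule := by
  refine ⟨fun x y z w => ?_, fun x y z w => ?_⟩ <;> simp only [idSym_apply]
  · linarith [hR x y z w, hR x y w z]
  · ring

theorem idSymSplit_mem_curv {S : Tensor4 V} (hS : S ∈ (altSym V).toSubmodule) :
    idSymSplit S ∈ (curv V).toSubmodule := by
  obtain ⟨ha, hs⟩ := hS
  refine ⟨fun x y z w => ?_, fun x y z w => ?_⟩ <;> simp only [idSymSplit_apply]
  · linarith [ha x y z w, ha x z y w, ha y z x w, ha x w y z, ha y w x z]
  · linarith [ha x y z w, ha y z x w, ha z x y w, ha w x y z, ha w y z x, ha w z x y,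
      hs w x y z, hs w y z x, hs w z x y]

theorem idSym_idSymSplit {S : Tensor4 V} (hS : SymmLast S) : idSym (idSymSplit S) = S :=
  Tensor4.ext4 fun x y z w => by
    simp only [idSym_apply, idSymSplit_apply]
    linarith [hS x y z w]

theorem idSym_eq_zero_iff (R : Tensor4 V) : idSym R = 0 ↔ AntisymmLast R := by
  refine ⟨fun h x y z w => ?_, fun h => Tensor4.ext4 fun x y z w => ?_⟩
  · have := Tensor4.congr_apply h x y z w
    simp only [idSym_apply, LinearMap.zero_apply] at this
    linarith
  · simp only [idSym_apply, LinearMap.zero_apply]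
    linarith [h x y z w]

/-- The map `id ⊗ π_s : 𝔯(V) → Λ²(V*) ⊗ S²(V*)`. -/
def idSymIntertwining (V : Type*) [AddCommGroup V] [Module ℝ V] :
    (curv V).toRepresentation.IntertwiningMap (altSym V).toRepresentation :=
  restrictIntertwining
    { toFun := idSym
      map_add' := fun R S => Tensor4.ext4 fun x y z w => by
        simp only [idSym_apply, LinearMap.add_apply]; ring
      map_smul' := fun c R => Tensor4.ext4 fun x y z w => by
        simp only [idSym_apply, LinearMap.smul_apply, smul_eq_mul, RingHom.id_apply]; ring }
    (fun _ _ => rfl) fun _ hR => idSym_mem_altSym hR.1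

/-- The splitting `Λ²(V*) ⊗ S²(V*) → 𝔯(V)` of `id ⊗ π_s`, called `σ₁` in the paper. -/
def idSymSplitIntertwining (V : Type*) [AddCommGroup V] [Module ℝ V] :
    (altSym V).toRepresentation.IntertwiningMap (curv V).toRepresentation :=
  restrictIntertwining
    { toFun := idSymSplit
      map_add' := fun R S => Tensor4.ext4 fun x y z w => by
        simp only [idSymSplit_apply, LinearMap.add_apply]; ring
      map_smul' := fun c R => Tensor4.ext4 fun x y z w => by
        simp only [idSymSplit_apply, LinearMap.smul_apply, smul_eq_mul, RingHom.id_apply]; ring }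
    (fun _ _ => rfl) fun _ hS => idSymSplit_mem_curv hS

theorem isSplitShortExact_curv : IsSplitShortExact (inclusionIntertwining algCurv_le_curv)
    (idSymIntertwining V) (idSymSplitIntertwining V) := by
  refine .of_inclusion _ (fun R => ?_) fun S => Subtype.ext (idSym_idSymSplit S.2.2)
  calc
    idSymIntertwining V R = 0 ↔ idSym (R : Tensor4 V) = 0 := Subtype.ext_iff
    _ ↔ AntisymmLast (R : Tensor4 V) := idSym_eq_zero_iff _
    _ ↔ (R : Tensor4 V) ∈ (algCurv V).toSubmodule :=
      ⟨mem_algCurv_of_antisymmLast R.2.1 R.2.2, fun h => h.2.2.2⟩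

end GeneralLinear

/-! ### Traces and the sequence of `O(V, B)`-modules -/

section Metric

variable {V : Type*} [AddCommGroup V] [Module ℝ V] {B : LinearMap.BilinForm ℝ V}

theorem self_mem_sym2 (hsymm : B.IsSymm) : B ∈ (sym2 V).toSubmodule := fun x y => hsymm.eq x y

theorem wedge_mem_algCurv {φ ψ : Tensor2 V} (hφ : φ ∈ (sym2 V).toSubmodule)
    (hψ : ψ ∈ (sym2 V).toSubmodule) : wedge φ ψ ∈ (algCurv V).toSubmodule := by
  refine mem_algCurv_of_antisymmLast (fun x y z w => ?_) (fun x y z w => ?_)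
    (fun x y z w => ?_) <;> simp only [wedge_apply]
  · ring
  · rw [hφ y x, hφ z x, hφ z y, hψ y x, hψ z x, hψ z y]
    ring
  · ring

theorem orep2_self (g : orthogonalGroup B) : orep2 B g B = B := by
  ext x y
  exact (orthogonalGroup B).inv_mem g.2 x y

theorem orep4_wedge (g : orthogonalGroup B) (φ ψ : Tensor2 V) :
    orep4 B g (wedge φ ψ) = wedge (orep2 B g φ) (orep2 B g ψ) := rfl

section OrthogonalBasis

variable {ι : Type*} {e : Module.Basis ι ℝ V}

theorem orthogonalBasis_apply_self_ne_zero (hB : B.Nondegenerate) (he : B.IsOrthoᵢ e) (i : ι) :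
    B (e i) (e i) ≠ 0 :=
  he.not_isOrtho_basis_self_of_separatingLeft hB.1 i

theorem apply_orthogonalBasis [Finite ι] (he : B.IsOrthoᵢ e) (x : V) (i : ι) :
    B x (e i) = e.repr x i * B (e i) (e i) := by
  cases nonempty_fintype ι
  conv_lhs => rw [← e.sum_repr x]
  rw [map_sum, LinearMap.sum_apply, Finset.sum_eq_single i]
  · simp only [map_smul, LinearMap.smul_apply, smul_eq_mul]
  · intro j _ hj
    rw [map_smul, LinearMap.smul_apply, show B (e j) (e i) = 0 from he hj, smul_zero]
  · exact fun hi => absurd (Finset.mem_univ i) hi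

variable [Fintype ι]

theorem sum_orthogonalBasis (hB : B.Nondegenerate) (he : B.IsOrthoᵢ e) (f : V →ₗ[ℝ] ℝ) (x : V) :
    ∑ i, (B (e i) (e i))⁻¹ * (f (e i) * B x (e i)) = f x := by
  conv_rhs => rw [← e.sum_repr x, map_sum]
  refine Finset.sum_congr rfl fun i _ => ?_
  have := orthogonalBasis_apply_self_ne_zero hB he i
  rw [apply_orthogonalBasis he x, map_smul, smul_eq_mul]
  field_simp

variable [FiniteDimensional ℝ V]

theorem metricTrace_eq_sum_orthogonal (hB : B.Nondegenerate) (hsymm : B.IsSymm)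
    (he : B.IsOrthoᵢ e) (ψ : Tensor2 V) :
    metricTrace B hB ψ = ∑ i, (B (e i) (e i))⁻¹ * ψ (e i) (e i) := by
  classical
  have gram : (Matrix.of fun i j => B (e i) (e j)) = Matrix.diagonal fun i => B (e i) (e i) := by
    ext i j
    rcases eq_or_ne i j with rfl | hij
    · rw [Matrix.of_apply, Matrix.diagonal_apply_eq]
    · rw [Matrix.of_apply, Matrix.diagonal_apply_ne _ hij]
      exact he hij
  have gram_inv : (Matrix.diagonal fun i => B (e i) (e i))⁻¹ =
      Matrix.diagonal fun i => (B (e i) (e i))⁻¹ := by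
    refine Matrix.inv_eq_right_inv ?_
    rw [Matrix.diagonal_mul_diagonal, ← Matrix.diagonal_one]
    exact congrArg _ (funext fun i => mul_inv_cancel₀ (orthogonalBasis_apply_self_ne_zero hB he i))
  rw [metricTrace_eq_sum e B hB hsymm, gram, gram_inv]
  simp only [Matrix.diagonal_apply, ite_mul, zero_mul, Finset.sum_ite_eq, Finset.mem_univ, if_true]

theorem rho14_eq_sum_orthogonal (hB : B.Nondegenerate) (hsymm : B.IsSymm)
    (he : B.IsOrthoᵢ e) (R : Tensor4 V) (y z : V) :
    rho14 B hB R y z = ∑ i, (B (e i) (e i))⁻¹ * R (e i) y z (e i) :=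
  metricTrace_eq_sum_orthogonal hB hsymm he ((R.flip y).flip z)

end OrthogonalBasis

theorem exists_orthogonalBasis [FiniteDimensional ℝ V] (hsymm : B.IsSymm) :
    ∃ e : Module.Basis (Fin (Module.finrank ℝ V)) ℝ V, B.IsOrthoᵢ e :=
  LinearMap.BilinForm.exists_orthogonal_basis (LinearMap.BilinForm.isSymm_iff.1 hsymm)

variable [FiniteDimensional ℝ V]

theorem metricTrace_self (hB : B.Nondegenerate) (hsymm : B.IsSymm) :
    metricTrace B hB B = Module.finrank ℝ V := by
  obtain ⟨e, he⟩ := exists_orthogonalBasis hsymm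
  rw [metricTrace_eq_sum_orthogonal hB hsymm he]
  simp [inv_mul_cancel₀ (orthogonalBasis_apply_self_ne_zero hB he _)]

theorem rho14_wedge_self (hB : B.Nondegenerate) (hsymm : B.IsSymm) {ψ : Tensor2 V}
    (hψ : ψ ∈ (sym2 V).toSubmodule) :
    rho14 B hB (wedge ψ B) =
      (1 / 2 : ℝ) • (metricTrace B hB ψ • B + ((Module.finrank ℝ V : ℝ) - 2) • ψ) := by
  obtain ⟨e, he⟩ := exists_orthogonalBasis hsymm
  ext y z
  have summand : ∀ i, (B (e i) (e i))⁻¹ * wedge ψ B (e i) y z (e i) =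
      (1 / 2 : ℝ) * ((B (e i) (e i))⁻¹ * ψ (e i) (e i) * B y z
        - (B (e i) (e i))⁻¹ * (ψ z (e i) * B y (e i))
        + (B (e i) (e i))⁻¹ * B (e i) (e i) * ψ y z
        - (B (e i) (e i))⁻¹ * (ψ y (e i) * B z (e i))) := fun i => by
    rw [wedge_apply, hψ (e i) z, self_mem_sym2 hsymm (e i) z]
    ring
  rw [rho14_eq_sum_orthogonal hB hsymm he, Finset.sum_congr rfl fun i _ => summand i,
    ← Finset.mul_sum]
  simp only [Finset.sum_sub_distrib, Finset.sum_add_distrib, ← Finset.sum_mul,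
    sum_orthogonalBasis hB he, ← metricTrace_eq_sum_orthogonal hB hsymm he,
    metricTrace_self hB hsymm, hψ z y, LinearMap.add_apply, LinearMap.smul_apply, smul_eq_mul]
  ring

theorem rho14_rho14Split (hm : 3 ≤ Module.finrank ℝ V) (hB : B.Nondegenerate) (hsymm : B.IsSymm)
    {ψ : Tensor2 V} (hψ : ψ ∈ (sym2 V).toSubmodule) : rho14 B hB (rho14Split B hB ψ) = ψ := by
  have hm' : (3 : ℝ) ≤ Module.finrank ℝ V := by exact_mod_cast hm
  have h1 : (Module.finrank ℝ V : ℝ) - 1 ≠ 0 := by linarith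
  have h2 : (Module.finrank ℝ V : ℝ) - 2 ≠ 0 := by linarith
  rw [rho14Split, map_sub, map_smul, map_smul, rho14_wedge_self hB hsymm hψ,
    rho14_wedge_self hB hsymm (self_mem_sym2 hsymm), metricTrace_self hB hsymm]
  ext y z
  simp only [LinearMap.add_apply, LinearMap.sub_apply, LinearMap.smul_apply, smul_eq_mul]
  field_simp
  ring

theorem rho14Split_mem_algCurv (hB : B.Nondegenerate) (hsymm : B.IsSymm) {ψ : Tensor2 V}
    (hψ : ψ ∈ (sym2 V).toSubmodule) : rho14Split B hB ψ ∈ (algCurv V).toSubmodule :=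
  Submodule.sub_mem _ (Submodule.smul_mem _ _ (wedge_mem_algCurv hψ (self_mem_sym2 hsymm)))
    (Submodule.smul_mem _ _ (wedge_mem_algCurv (self_mem_sym2 hsymm) (self_mem_sym2 hsymm)))

theorem rho14_mem_sym2 (hB : B.Nondegenerate) (hsymm : B.IsSymm) {R : Tensor4 V}
    (hR : R ∈ (algCurv V).toSubmodule) : rho14 B hB R ∈ (sym2 V).toSubmodule := by
  obtain ⟨e, he⟩ := exists_orthogonalBasis hsymm
  intro y z
  rw [rho14_eq_sum_orthogonal hB hsymm he, rho14_eq_sum_orthogonal hB hsymm he]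
  refine Finset.sum_congr rfl fun i _ => ?_
  rw [hR.2.2.1 (e i) y z (e i), hR.1 z, hR.2.2.2 (e i) z, neg_neg]

theorem rho14Split_orep2 (hB : B.Nondegenerate) (g : orthogonalGroup B) (ψ : Tensor2 V) :
    rho14Split B hB (orep2 B g ψ) = orep4 B g (rho14Split B hB ψ) := by
  rw [rho14Split, rho14Split, metricTrace_orep2, map_sub, map_smul, map_smul, orep4_wedge,
    orep4_wedge, orep2_self]

/-- The trace `ρ₁₄ : 𝔞(V) → S²(V*)` as a map of `O(V, B)`-modules. -/
def rho14Intertwining (hB : B.Nondegenerate) (hsymm : B.IsSymm) :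
    (oAlgCurv B).toRepresentation.IntertwiningMap (oSym2 B).toRepresentation :=
  restrictIntertwining (rho14 B hB) (rho14_orep4 B hB) fun _ hR => rho14_mem_sym2 hB hsymm hR

/-- The splitting `S²(V*) → 𝔞(V)` of `ρ₁₄`, called `σ₂` in the paper. -/
def rho14SplitIntertwining (hB : B.Nondegenerate) (hsymm : B.IsSymm) :
    (oSym2 B).toRepresentation.IntertwiningMap (oAlgCurv B).toRepresentation :=
  restrictIntertwining
    { toFun := rho14Split B hB
      map_add' := fun φ ψ => Tensor4.ext4 fun x y z w => by
        simp only [rho14Split, wedge_apply, map_add, LinearMap.add_apply, LinearMap.sub_apply,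
          LinearMap.smul_apply, smul_eq_mul]
        ring
      map_smul' := fun c ψ => Tensor4.ext4 fun x y z w => by
        simp only [rho14Split, wedge_apply, map_smul, LinearMap.sub_apply,
          LinearMap.smul_apply, smul_eq_mul, RingHom.id_apply]
        ring }
    (rho14Split_orep2 hB) fun _ hψ => rho14Split_mem_algCurv hB hsymm hψ

theorem weyl_le_oAlgCurv (hB : B.Nondegenerate) :
    (weyl B hB).toSubmodule ≤ (oAlgCurv B).toSubmodule := inf_le_right

theorem sym2Zero_le_oSym2 (hB : B.Nondegenerate) :
    (sym2Zero B hB).toSubmodule ≤ (oSym2 B).toSubmodule := inf_le_right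

theorem isSplitShortExact_oAlgCurv (hm : 3 ≤ Module.finrank ℝ V) (hsymm : B.IsSymm)
    (hB : B.Nondegenerate) :
    IsSplitShortExact (inclusionIntertwining (weyl_le_oAlgCurv hB)) (rho14Intertwining hB hsymm)
      (rho14SplitIntertwining hB hsymm) :=
  .of_inclusion _ (fun R => Subtype.ext_iff.trans ⟨fun h => ⟨h, R.2⟩, fun h => h.1⟩)
    fun ψ => Subtype.ext (rho14_rho14Split hm hB hsymm ψ.2)

/-- The normalized trace `S²(V*) → ℝ`, `ψ ↦ τ(ψ) / dim V`. -/
def normalizedTraceIntertwining (hB : B.Nondegenerate) : (oSym2 B).toRepresentation.IntertwiningMap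
    (Representation.trivial ℝ (orthogonalGroup B) ℝ) where
  toLinearMap :=
    (Module.finrank ℝ V : ℝ)⁻¹ • (metricTrace B hB ∘ₗ (oSym2 B).toSubmodule.subtype)
  isIntertwining' g := LinearMap.ext fun ψ =>
    congrArg ((Module.finrank ℝ V : ℝ)⁻¹ * ·) (metricTrace_orep2 B hB g ψ)

/-- The inclusion `ℝ → S²(V*)` of the multiples of the metric. -/
def metricIntertwining (hsymm : B.IsSymm) :
    (Representation.trivial ℝ (orthogonalGroup B) ℝ).IntertwiningMap
      (oSym2 B).toRepresentation where
  toLinearMap := LinearMap.toSpanSingleton ℝ (oSym2 B).toSubmodule ⟨B, self_mem_sym2 hsymm⟩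
  isIntertwining' g := LinearMap.ext fun c => Subtype.ext <|
    (congrArg (c • ·) (orep2_self g).symm).trans (map_smul (orep2 B g) c B).symm

theorem isSplitShortExact_oSym2 (hm : Module.finrank ℝ V ≠ 0) (hsymm : B.IsSymm)
    (hB : B.Nondegenerate) :
    IsSplitShortExact (inclusionIntertwining (sym2Zero_le_oSym2 hB))
      (normalizedTraceIntertwining hB) (metricIntertwining hsymm) := by
  have hm' : (Module.finrank ℝ V : ℝ) ≠ 0 := Nat.cast_ne_zero.2 hm
  refine .of_inclusion _ (fun ψ => ?_) fun c => ?_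
  · calc
      (Module.finrank ℝ V : ℝ)⁻¹ * metricTrace B hB ψ = 0 ↔ metricTrace B hB ψ = 0 :=
        mul_eq_zero_iff_left (inv_ne_zero hm')
      _ ↔ (ψ : Tensor2 V) ∈ (sym2Zero B hB).toSubmodule := ⟨fun h => ⟨h, ψ.2⟩, fun h => h.1⟩
  · change (Module.finrank ℝ V : ℝ)⁻¹ * metricTrace B hB (c • B) = c
    rw [map_smul, metricTrace_self hB hsymm, smul_eq_mul]
    field_simp

/-- The isomorphism `(W, ψ, c) ↦ W + σ₂(ψ + c B)` obtained by composing the two splittings. -/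
def curvatureDecomposition (hm : 3 ≤ Module.finrank ℝ V) (hsymm : B.IsSymm)
    (hB : B.Nondegenerate) :
    ((weyl B hB).toRepresentation.prod ((sym2Zero B hB).toRepresentation.prod
      (Representation.trivial ℝ (orthogonalGroup B) ℝ))).Equiv (oAlgCurv B).toRepresentation :=
  (prodCongrEquiv (.refl _) (isSplitShortExact_oSym2 (by omega) hsymm hB).prodEquiv).trans
    (isSplitShortExact_oAlgCurv hm hsymm hB).prodEquiv

theorem curvatureDecomposition_apply (hm : 3 ≤ Module.finrank ℝ V) (hsymm : B.IsSymm)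
    (hB : B.Nondegenerate) (W : (weyl B hB).toSubmodule) (ψ : (sym2Zero B hB).toSubmodule)
    (c : ℝ) :
    (curvatureDecomposition hm hsymm hB (W, ψ, c) : Tensor4 V) =
      (W : Tensor4 V) + rho14Split B hB ((ψ : Tensor2 V) + c • B) := rfl

theorem finrank_algCurv_eq_add (hm : 3 ≤ Module.finrank ℝ V) (hsymm : B.IsSymm)
    (hB : B.Nondegenerate) :
    Module.finrank ℝ (algCurv V).toSubmodule =
      Module.finrank ℝ (weyl B hB).toSubmodule + Module.finrank ℝ (sym2 V).toSubmodule :=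
  (isSplitShortExact_oAlgCurv hm hsymm hB).finrank_eq_add

theorem finrank_sym2_eq_add_one (hm : Module.finrank ℝ V ≠ 0) (hsymm : B.IsSymm)
    (hB : B.Nondegenerate) :
    Module.finrank ℝ (sym2 V).toSubmodule =
      Module.finrank ℝ (sym2Zero B hB).toSubmodule + 1 :=
  (isSplitShortExact_oSym2 hm hsymm hB).finrank_eq_add.trans
    (congrArg _ (Module.finrank_self ℝ))

end Metric

/-! ### Permutations of arguments, and dimensions -/

section Permutation

open Equiv.Perm

instance decidableRelSameCycleSetoid {κ : Type*} [Fintype κ] [DecidableEq κ] (σ : Equiv.Perm κ) :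
    DecidableRel (SameCycle.setoid σ) :=
  inferInstanceAs (DecidableRel σ.SameCycle)

theorem apply_eq_of_sameCycle {κ ι : Type*} {σ : Equiv.Perm κ} {c : κ → ι}
    (hc : ∀ t, c (σ t) = c t) {s t : κ} (hst : σ.SameCycle s t) : c s = c t := by
  obtain ⟨n, rfl⟩ := hst
  induction n with
  | zero => rfl
  | succ n ih => rw [add_comm, zpow_add, zpow_one, mul_apply, hc, ih]
  | pred n ih =>
    rw [ih, ← hc ((σ ^ (-(n : ℤ) - 1)) s), ← mul_apply, ← zpow_one_add, add_sub_cancel]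

/-- The number of cycles of a permutation, counting its fixed points. -/
def numCycles {κ : Type*} [Fintype κ] [DecidableEq κ] (σ : Equiv.Perm κ) : ℕ :=
  Fintype.card (Quotient (SameCycle.setoid σ))

theorem card_invariant_functions {κ ι : Type*} [Fintype κ] [DecidableEq κ] [Fintype ι]
    [DecidableEq ι] (σ : Equiv.Perm κ) :
    Fintype.card {c : κ → ι // c ∘ σ = c} =
      Fintype.card ι ^ numCycles σ := by
  rw [numCycles, ← Fintype.card_fun]
  exact Fintype.card_congr
    { toFun := fun c => Quotient.lift c.1 fun _ _ => apply_eq_of_sameCycle (congrFun c.2)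
      invFun := fun c => ⟨fun t => c (Quotient.mk _ t), funext fun t =>
        congrArg c (Quotient.sound (sameCycle_apply_left.2 (SameCycle.refl σ t)))⟩
      left_inv := fun c => rfl
      right_inv := fun c => funext fun t => Quotient.inductionOn t fun _ => rfl }

variable {k : Type*} [CommRing k]

theorem trace_of_apply_basis {X n : Type*} [AddCommGroup X] [Module k X] [Fintype n]
    [DecidableEq n] (b : Module.Basis n k X) (s : n → n) {f : X →ₗ[k] X}
    (hf : ∀ i, f (b i) = b (s i)) :
    LinearMap.trace k X f = Fintype.card {i // s i = i} := by
  rw [LinearMap.trace_eq_matrix_trace k b, Matrix.trace]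
  simp [LinearMap.toMatrix_apply, hf, Finsupp.single_apply, Fintype.card_subtype]

theorem trace_domDomCongr [StrongRankCondition k] {V κ : Type*} [AddCommGroup V] [Module k V]
    [Module.Free k V] [Module.Finite k V] [Fintype κ] [DecidableEq κ] (σ : Equiv.Perm κ) :
    LinearMap.trace k (MultilinearMap k (fun _ : κ => V) k)
        (MultilinearMap.domDomCongrLinearEquiv k k V k σ).toLinearMap =
      (Module.finrank k V : k) ^ numCycles σ := by
  let e := Module.finBasis k V
  let b := (Basis.multilinearMap (fun _ : κ => e) (Module.Basis.singleton Unit k)).reindex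
    (Equiv.prodPUnit _)
  have b_apply : ∀ c v, b c v = ∏ t, e.repr (v t) (c t) := fun c v => by
    rw [Module.Basis.reindex_apply, Basis.multilinearMap_apply_apply]
    simp
  have permutes_basis : ∀ c, (MultilinearMap.domDomCongrLinearEquiv k k V k σ).toLinearMap (b c) =
      b (c ∘ σ.symm) := fun c => by
    ext v
    rw [b_apply]
    exact (b_apply c fun t => v (σ t)).trans (Fintype.prod_equiv σ _ _ fun t => by simp)
  have invariant_iff : ∀ c : κ → Fin (Module.finrank k V), c ∘ σ.symm = c ↔ c ∘ σ = c := fun c =>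
    (Equiv.comp_symm_eq σ c c).trans eq_comm
  rw [trace_of_apply_basis b _ permutes_basis,
    Fintype.card_congr (Equiv.subtypeEquivRight invariant_iff), card_invariant_functions,
    Fintype.card_fin, Nat.cast_pow]

end Permutation

section Dimension

variable (V : Type*) [AddCommGroup V] [Module ℝ V]

/-- `⊗²V*` as the space of multilinear forms in a family of two vectors. -/
def multilinear2 : Tensor2 V ≃ₗ[ℝ] MultilinearMap ℝ (fun _ : Fin 2 => V) ℝ :=
  (LinearEquiv.congrRight ((LinearEquiv.congrRight
    (MultilinearMap.constLinearEquivOfIsEmpty ℝ ℝ (fun _ : Fin 0 => V) ℝ)).trans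
    (multilinearCurryLeftEquiv ℝ (fun _ : Fin 1 => V) ℝ).symm)).trans
    (multilinearCurryLeftEquiv ℝ (fun _ : Fin 2 => V) ℝ).symm

/-- `⊗⁴V*` as the space of multilinear forms in a family of four vectors. -/
def multilinear4 : Tensor4 V ≃ₗ[ℝ] MultilinearMap ℝ (fun _ : Fin 4 => V) ℝ :=
  (LinearEquiv.congrRight ((LinearEquiv.congrRight (multilinear2 V)).trans
    (multilinearCurryLeftEquiv ℝ (fun _ : Fin 3 => V) ℝ).symm)).trans
    (multilinearCurryLeftEquiv ℝ (fun _ : Fin 4 => V) ℝ).symm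

variable {V}

theorem multilinear2_apply (ψ : Tensor2 V) (v : Fin 2 → V) :
    multilinear2 V ψ v = ψ (v 0) (v 1) := rfl

theorem multilinear4_apply (R : Tensor4 V) (v : Fin 4 → V) :
    multilinear4 V R v = R (v 0) (v 1) (v 2) (v 3) := rfl

/-- The action on `⊗⁴V*` of a permutation of the arguments. -/
def Tensor4.permute (σ : Equiv.Perm (Fin 4)) : Tensor4 V →ₗ[ℝ] Tensor4 V :=
  (multilinear4 V).symm.conj (MultilinearMap.domDomCongrLinearEquiv ℝ ℝ V ℝ σ).toLinearMap

open Equiv in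
/-- The projector of `⊗⁴V*` onto `Λ²(V*) ⊗ S²(V*)`. -/
def altSymProjector : Tensor4 V →ₗ[ℝ] Tensor4 V :=
  (1 / 4 : ℝ) • (Tensor4.permute 1 - Tensor4.permute (swap 0 1) + Tensor4.permute (swap 2 3) -
    Tensor4.permute (swap 0 1 * swap 2 3))

theorem altSymProjector_apply (R : Tensor4 V) (x y z w : V) :
    altSymProjector R x y z w = 1 / 4 * (R x y z w - R y x z w + R x y w z - R y x w z) := rfl

open Equiv in
/-- A projector of `⊗⁴V*` onto `𝔯(V)`: the alternation over the first two arguments minus the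
alternation over the first three. -/
def curvProjector : Tensor4 V →ₗ[ℝ] Tensor4 V :=
  (1 / 6 : ℝ) • ((2 : ℝ) • Tensor4.permute 1 - (2 : ℝ) • Tensor4.permute (swap 0 1) +
    Tensor4.permute (swap 1 2) + Tensor4.permute (swap 0 2) -
    Tensor4.permute (swap 0 1 * swap 1 2) - Tensor4.permute (swap 1 2 * swap 0 1))

theorem curvProjector_apply (R : Tensor4 V) (x y z w : V) :
    curvProjector R x y z w = 1 / 6 * (2 * R x y z w - 2 * R y x z w + R x z y w + R z y x w -
      R y z x w - R z x y w) := rfl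

variable [FiniteDimensional ℝ V]

theorem trace_permute (σ : Equiv.Perm (Fin 4)) :
    LinearMap.trace ℝ _ (Tensor4.permute σ : Tensor4 V →ₗ[ℝ] Tensor4 V) =
      (Module.finrank ℝ V : ℝ) ^ numCycles σ :=
  (LinearMap.trace_conj' _ _).trans (trace_domDomCongr σ)

theorem trace_lflip :
    LinearMap.trace ℝ (Tensor2 V) LinearMap.lflip.toLinearMap = Module.finrank ℝ V := by
  have lflip_eq : LinearMap.lflip.toLinearMap = (multilinear2 V).symm.conj
      (MultilinearMap.domDomCongrLinearEquiv ℝ ℝ V ℝ (Equiv.swap 0 1)).toLinearMap := by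
    refine LinearMap.ext fun ψ => (multilinear2 V).injective ?_
    exact ((multilinear2 V).apply_symm_apply _).symm
  have one_cycle : numCycles (Equiv.swap 0 1 : Equiv.Perm (Fin 2)) = 1 := by decide
  rw [lflip_eq, LinearMap.trace_conj', trace_domDomCongr, one_cycle, pow_one]

theorem finrank_eq_trace {X : Type*} [AddCommGroup X] [Module ℝ X] [FiniteDimensional ℝ X]
    {W : Submodule ℝ X} (f : X →ₗ[ℝ] X) (map_mem : ∀ x, f x ∈ W) (map_id : ∀ x ∈ W, f x = x) :
    (Module.finrank ℝ W : ℝ) = LinearMap.trace ℝ X f :=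
  (LinearMap.IsProj.trace ⟨map_mem, map_id⟩).symm

theorem finrank_sym2 :
    (Module.finrank ℝ (sym2 V).toSubmodule : ℝ) =
      1 / 2 * Module.finrank ℝ V * (Module.finrank ℝ V + 1) := by
  have finrank_tensor2 : (Module.finrank ℝ (Tensor2 V) : ℝ) = Module.finrank ℝ V ^ 2 := by
    simp [Module.finrank_linearMap, sq]
  rw [finrank_eq_trace ((1 / 2 : ℝ) • (LinearMap.id + LinearMap.lflip.toLinearMap)), map_smul,
    map_add, LinearMap.trace_id, finrank_tensor2, trace_lflip, smul_eq_mul]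
  · ring
  · intro ψ x y
    change (1 / 2 : ℝ) * (ψ x y + ψ y x) = (1 / 2 : ℝ) * (ψ y x + ψ x y)
    ring
  · intro ψ hψ
    ext x y
    change (1 / 2 : ℝ) * (ψ x y + ψ y x) = ψ x y
    rw [hψ y x]
    ring

open Equiv in
theorem finrank_altSym :
    (Module.finrank ℝ (altSym V).toSubmodule : ℝ) =
      1 / 4 * (Module.finrank ℝ V) ^ 2 * ((Module.finrank ℝ V) ^ 2 - 1) := by
  have trace_altSymProjector : LinearMap.trace ℝ (Tensor4 V) altSymProjector =
      1 / 4 * (Module.finrank ℝ V) ^ 2 * ((Module.finrank ℝ V) ^ 2 - 1) := by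
    have four_cycles : numCycles (1 : Perm (Fin 4)) = 4 := by decide
    have three_cycles : numCycles (swap 0 1 : Perm (Fin 4)) = 3 ∧
      numCycles (swap 2 3 : Perm (Fin 4)) = 3 := by decide
    have two_cycles : numCycles (swap 0 1 * swap 2 3 : Perm (Fin 4)) = 2 := by decide
    simp only [altSymProjector, map_smul, map_sub, map_add, trace_permute, smul_eq_mul,
      four_cycles, three_cycles, two_cycles]
    ring
  rw [← trace_altSymProjector]
  refine finrank_eq_trace _ (fun R => ⟨fun x y z w => ?_, fun x y z w => ?_⟩)
    fun R hR => Tensor4.ext4 fun x y z w => ?_ <;> simp only [altSymProjector_apply]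
  · ring
  · ring
  · linarith [hR.1 x y z w, hR.2 x y z w, hR.1 x y w z]

open Equiv in
theorem finrank_curv :
    (Module.finrank ℝ (curv V).toSubmodule : ℝ) =
      1 / 3 * (Module.finrank ℝ V) ^ 2 * ((Module.finrank ℝ V) ^ 2 - 1) := by
  have trace_curvProjector : LinearMap.trace ℝ (Tensor4 V) curvProjector =
      1 / 3 * (Module.finrank ℝ V) ^ 2 * ((Module.finrank ℝ V) ^ 2 - 1) := by
    have four_cycles : numCycles (1 : Perm (Fin 4)) = 4 := by decide
    have three_cycles : numCycles (swap 0 1 : Perm (Fin 4)) = 3 ∧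
      numCycles (swap 1 2 : Perm (Fin 4)) = 3 ∧ numCycles (swap 0 2 : Perm (Fin 4)) = 3 := by decide
    have two_cycles : numCycles (swap 0 1 * swap 1 2 : Perm (Fin 4)) = 2 ∧
      numCycles (swap 1 2 * swap 0 1 : Perm (Fin 4)) = 2 := by decide
    simp only [curvProjector, map_smul, map_sub, map_add, trace_permute, smul_eq_mul,
      four_cycles, three_cycles, two_cycles]
    ring
  rw [← trace_curvProjector]
  refine finrank_eq_trace _ (fun R => ⟨fun x y z w => ?_, fun x y z w => ?_⟩)
    fun R hR => Tensor4.ext4 fun x y z w => ?_ <;> simp only [curvProjector_apply]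
  · ring
  · ring
  · linarith [hR.1 x y z w, hR.2 x y z w, hR.1 x z y w, hR.1 y z x w, hR.1 z x y w]

theorem finrank_algCurv :
    (Module.finrank ℝ (algCurv V).toSubmodule : ℝ) =
      1 / 12 * (Module.finrank ℝ V) ^ 2 * ((Module.finrank ℝ V) ^ 2 - 1) := by
  have finrank_eq_add : (Module.finrank ℝ (curv V).toSubmodule : ℝ) =
      Module.finrank ℝ (algCurv V).toSubmodule + Module.finrank ℝ (altSym V).toSubmodule := by
    exact_mod_cast (isSplitShortExact_curv (V := V)).finrank_eq_add
  rw [finrank_curv, finrank_altSym] at finrank_eq_add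
  linarith

end Dimension

/-! ### Multilinear forms under the orthogonal group -/

section Reflections

variable {V : Type*} [AddCommGroup V] [Module ℝ V] {B : LinearMap.BilinForm ℝ V} {ι : Type*}
  {e : Module.Basis ι ℝ V}

theorem exists_reflection (hsymm : B.IsSymm) {v : V} (hv : B v v ≠ 0) :
    ∃ g ∈ orthogonalGroup B, ∀ x, g x = x - (2 * B v x / B v v) • v := by
  have hrefl : LinearMap.IsReflective B v :=
    ⟨IsRegular.of_ne_zero hv, fun _ => (isUnit_iff_ne_zero.2 hv).dvd⟩
  refine ⟨Module.reflection (LinearMap.IsReflective.coroot_apply_self B hrefl),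
    LinearMap.IsReflective.isOrthogonal_reflection B hrefl
    (LinearMap.BilinForm.isSymm_iff.1 hsymm), fun x => ?_⟩
  rw [Module.reflection_apply, ← LinearMap.IsReflective.apply_self_mul_coroot_apply B hrefl,
    mul_div_cancel_left₀ _ hv]

theorem exists_signChange [DecidableEq ι] (hsymm : B.IsSymm) (hB : B.Nondegenerate)
    (he : B.IsOrthoᵢ e) (p : ι) :
    ∃ g ∈ orthogonalGroup B, ∀ i, g (e i) = (if i = p then -1 else 1 : ℝ) • e i := by
  have hp := orthogonalBasis_apply_self_ne_zero hB he p
  obtain ⟨g, hg, g_apply⟩ := exists_reflection hsymm hp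
  refine ⟨g, hg, fun i => ?_⟩
  rw [g_apply]
  split_ifs with hi
  · rw [hi, mul_div_cancel_right₀ _ hp]
    module
  · rw [show B (e p) (e i) = 0 from he (Ne.symm hi), mul_zero, zero_div]
    module

theorem exists_mixingReflection (hsymm : B.IsSymm) (hB : B.Nondegenerate)
    (he : B.IsOrthoᵢ e) {p q : ι} (hpq : p ≠ q) :
    ∃ g ∈ orthogonalGroup B, ∃ α β γ δ : ℝ, α ≠ 0 ∧ β ≠ 0 ∧ γ ≠ 0 ∧ δ ≠ 0 ∧
      g (e p) = α • e p + β • e q ∧ g (e q) = γ • e p + δ • e q ∧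
      ∀ i, i ≠ p → i ≠ q → g (e i) = e i := by
  have hp := orthogonalBasis_apply_self_ne_zero hB he p
  have hq := orthogonalBasis_apply_self_ne_zero hB he q
  have ortho : ∀ {i j}, i ≠ j → B (e i) (e j) = 0 := fun hij => he hij
  set x := B (e p) (e p) with hx
  set y := B (e q) (e q) with hy
  obtain ⟨c, hc, hadd, hsub⟩ : ∃ c : ℝ, c ≠ 0 ∧ x + c ^ 2 * y ≠ 0 ∧ x - c ^ 2 * y ≠ 0 := by
    by_cases h : x + y ≠ 0 ∧ x - y ≠ 0
    · exact ⟨1, one_ne_zero, by simpa using h.1, by simpa using h.2⟩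
    · refine ⟨2, two_ne_zero, fun h1 => h ⟨fun h2 => hq ?_, fun h2 => hq ?_⟩,
        fun h1 => h ⟨fun h2 => hq ?_, fun h2 => hq ?_⟩⟩ <;> linarith
  have apply_v : ∀ i, B (e p + c • e q) (e i) = B (e p) (e i) + c * B (e q) (e i) := fun i => by
    rw [map_add, map_smul, LinearMap.add_apply, LinearMap.smul_apply, smul_eq_mul]
  have apply_v_self : B (e p + c • e q) (e p + c • e q) = x + c ^ 2 * y := by
    rw [map_add, map_smul, apply_v, apply_v, ortho hpq, ortho hpq.symm, smul_eq_mul]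
    ring
  obtain ⟨g, hg, g_apply⟩ := exists_reflection hsymm (apply_v_self ▸ hadd)
  rw [apply_v_self] at g_apply
  refine ⟨g, hg, -(x - c ^ 2 * y) / (x + c ^ 2 * y), -(2 * c * x) / (x + c ^ 2 * y),
    -(2 * c * y) / (x + c ^ 2 * y), (x - c ^ 2 * y) / (x + c ^ 2 * y),
    div_ne_zero (neg_ne_zero.2 hsub) hadd,
    div_ne_zero (neg_ne_zero.2 (mul_ne_zero (mul_ne_zero two_ne_zero hc) hp)) hadd,
    div_ne_zero (neg_ne_zero.2 (mul_ne_zero (mul_ne_zero two_ne_zero hc) hq)) hadd,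
    div_ne_zero hsub hadd, ?_, ?_, fun i hip hiq => ?_⟩
  · rw [g_apply, apply_v, ortho hpq.symm, ← hx]
    match_scalars <;> field_simp <;> ring
  · rw [g_apply, apply_v, ortho hpq, ← hy]
    match_scalars <;> field_simp <;> ring
  · rw [g_apply, apply_v, ortho hip.symm, ortho hiq.symm]
    simp

end Reflections

section InvariantForm

variable {V : Type*} [AddCommGroup V] [Module ℝ V] {B : LinearMap.BilinForm ℝ V} {ι : Type*}
  [Fintype ι] {e : Module.Basis ι ℝ V} (κ : Type*) [Fintype κ] [DecidableEq κ]

/-- The form which the metric `B` induces on the multilinear forms in a `κ`-indexed family of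
vectors, computed in a `B`-orthogonal basis `e`. -/
def multilinearForm (B : LinearMap.BilinForm ℝ V) (e : Module.Basis ι ℝ V) :
    LinearMap.BilinForm ℝ (MultilinearMap ℝ (fun _ : κ => V) ℝ) :=
  LinearMap.mk₂ ℝ
    (fun F G => ∑ c : κ → ι, (∏ t, (B (e (c t)) (e (c t)))⁻¹) * (F (e ∘ c) * G (e ∘ c)))
    (fun F F' G => by simp only [add_apply, add_mul, mul_add, Finset.sum_add_distrib])
    (fun r F G => by
      simp only [smul_apply, smul_eq_mul, Finset.mul_sum, mul_assoc,
        mul_left_comm r])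
    (fun F G G' => by simp only [add_apply, mul_add, Finset.sum_add_distrib])
    (fun r F G => by
      simp only [smul_apply, smul_eq_mul, Finset.mul_sum, mul_left_comm r])

variable {κ}

theorem multilinearForm_apply (F G : MultilinearMap ℝ (fun _ : κ => V) ℝ) :
    multilinearForm κ B e F G =
      ∑ c : κ → ι, (∏ t, (B (e (c t)) (e (c t)))⁻¹) * (F (e ∘ c) * G (e ∘ c)) :=
  rfl

theorem compLinearMap_apply_basis (F : MultilinearMap ℝ (fun _ : κ => V) ℝ)
    (f : V →ₗ[ℝ] V) (c : κ → ι) :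
    F.compLinearMap (fun _ => f) (e ∘ c) =
      ∑ d : κ → ι, (∏ t, e.repr (f (e (c t))) (d t)) * F (e ∘ d) := by
  have expand : (fun t => f (e (c t))) = fun t => ∑ j, e.repr (f (e (c t))) j • e j :=
    funext fun t => (e.sum_repr _).symm
  rw [MultilinearMap.compLinearMap_apply]
  refine (congrArg F expand).trans ?_
  rw [MultilinearMap.map_sum]
  exact Finset.sum_congr rfl fun d _ => F.map_smul_univ _ _

variable [FiniteDimensional ℝ V]

theorem sum_repr_mul_repr [DecidableEq ι] (hsymm : B.IsSymm) (hB : B.Nondegenerate)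
    (he : B.IsOrthoᵢ e) {g : V ≃ₗ[ℝ] V} (hg : g ∈ orthogonalGroup B) (j k : ι) :
    ∑ i, (B (e i) (e i))⁻¹ * (e.repr (g (e i)) j * e.repr (g (e i)) k) =
      if j = k then (B (e j) (e j))⁻¹ else 0 := by
  have invariance := metricTrace_orep2 B hB ⟨g, hg⟩⁻¹
    ((LinearMap.mul ℝ ℝ).compl₁₂ (e.coord j) (e.coord k))
  rw [metricTrace_eq_sum_orthogonal hB hsymm he, metricTrace_eq_sum_orthogonal hB hsymm he]
    at invariance
  refine invariance.trans ?_
  simp only [LinearMap.compl₁₂_apply, LinearMap.mul_apply', Module.Basis.coord_apply,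
    Module.Basis.repr_self, Finsupp.single_apply, mul_ite, mul_one, mul_zero, Finset.sum_ite_eq',
    Finset.mem_univ, if_true]
  rcases eq_or_ne j k with rfl | hjk
  · simp only [if_true]
  · simp only [hjk, hjk.symm, if_false]

theorem multilinearForm_compLinearMap (hsymm : B.IsSymm) (hB : B.Nondegenerate)
    (he : B.IsOrthoᵢ e) {g : V ≃ₗ[ℝ] V} (hg : g ∈ orthogonalGroup B)
    (F G : MultilinearMap ℝ (fun _ : κ => V) ℝ) :
    multilinearForm κ B e (F.compLinearMap fun _ => g) (G.compLinearMap fun _ => g) =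
      multilinearForm κ B e F G := by
  classical
  let w : ι → ℝ := fun i => (B (e i) (e i))⁻¹
  let a : ι → ι → ℝ := fun i j => e.repr (g (e i)) j
  have contract : ∀ d d' : κ → ι,
      ∑ c : κ → ι, (∏ t, w (c t)) * ((∏ t, a (c t) (d t)) * ∏ t, a (c t) (d' t)) =
        if d = d' then ∏ t, w (d t) else 0 := fun d d' => by
    simp only [← Finset.prod_mul_distrib]
    rw [← Fintype.prod_sum fun t i => w i * (a i (d t) * a i (d' t)),
      Finset.prod_congr rfl fun t _ => sum_repr_mul_repr hsymm hB he hg (d t) (d' t),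
      Fintype.prod_ite_zero]
    simp only [funext_iff, w]
  calc multilinearForm κ B e (F.compLinearMap fun _ => g) (G.compLinearMap fun _ => g)
      = ∑ c : κ → ι, (∏ t, w (c t)) * ((∑ d : κ → ι, (∏ t, a (c t) (d t)) * F (e ∘ d)) *
          ∑ d' : κ → ι, (∏ t, a (c t) (d' t)) * G (e ∘ d')) := by
        exact Finset.sum_congr rfl fun c _ => by
          rw [compLinearMap_apply_basis, compLinearMap_apply_basis]
          rfl
    _ = ∑ d : κ → ι, ∑ d' : κ → ι, (∑ c : κ → ι, (∏ t, w (c t)) *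
          ((∏ t, a (c t) (d t)) * ∏ t, a (c t) (d' t))) * (F (e ∘ d) * G (e ∘ d')) := by
        simp only [Finset.sum_mul_sum]
        simp only [Finset.mul_sum, Finset.sum_mul]
        rw [Finset.sum_comm]
        refine Finset.sum_congr rfl fun d _ => Finset.sum_comm.trans ?_
        exact Finset.sum_congr rfl fun d' _ => Finset.sum_congr rfl fun c _ => by ring
    _ = multilinearForm κ B e F G := by
        simp only [contract, ite_mul, zero_mul, Finset.sum_ite_eq, Finset.mem_univ, if_true]
        rfl

end InvariantForm

section Relabelling

variable {V : Type*} [AddCommGroup V] [Module ℝ V] {ι κ : Type*} {e : Module.Basis ι ℝ V}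

/-- The multilinear forms whose components in the basis `e` vanish at every family of indices that
omits one of the values of `q`. When `q` is injective, only the components at permutations of `q`
are left. -/
def supportedOn (e : Module.Basis ι ℝ V) (q : κ → ι) :
    Submodule ℝ (MultilinearMap ℝ (fun _ : κ => V) ℝ) where
  carrier := {F | ∀ c : κ → ι, ¬ Set.range q ⊆ Set.range c → F (e ∘ c) = 0}
  zero_mem' _ _ := rfl
  add_mem' hF hG c hc := by rw [add_apply, hF c hc, hG c hc, add_zero]
  smul_mem' r F hF c hc := by rw [smul_apply, hF c hc, smul_zero]

theorem range_subset_of_mem_supportedOn {q : κ → ι} {F : MultilinearMap ℝ (fun _ : κ => V) ℝ}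
    (hF : F ∈ supportedOn e q) {c : κ → ι} (hc : F (e ∘ c) ≠ 0) : Set.range q ⊆ Set.range c :=
  by_contra fun h => hc (hF c h)

theorem exists_perm_of_range_subset [Finite κ] {q c : κ → ι} (hq : Function.Injective q)
    (h : Set.range q ⊆ Set.range c) : ∃ σ : Equiv.Perm κ, c = q ∘ σ := by
  choose f hf using fun t => h ⟨t, rfl⟩
  have f_inj : Function.Injective f := fun s t hst => hq (by rw [← hf s, hst, hf t])
  let σ := Equiv.ofBijective f (Finite.injective_iff_bijective.1 f_inj)
  refine ⟨σ.symm, funext fun t => ?_⟩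
  rw [Function.comp_apply, ← hf]
  exact congrArg c (σ.apply_symm_apply t).symm

theorem apply_eq_zero_of_not_injective [Finite κ] {q : κ → ι} (hq : Function.Injective q)
    {F : MultilinearMap ℝ (fun _ : κ => V) ℝ} (hF : F ∈ supportedOn e q) {c : κ → ι}
    (hc : ¬ Function.Injective c) : F (e ∘ c) = 0 := hF c fun h => hc <| by
  obtain ⟨σ, rfl⟩ := exists_perm_of_range_subset hq h
  exact hq.comp σ.injective

theorem exists_coord_eq_zero {q c : κ → ι} (h : ¬ Set.range q ⊆ Set.range c) :
    ∃ u, ∀ t, e.coord (q u) (e (c t)) = 0 := by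
  obtain ⟨_, ⟨u, rfl⟩, hu⟩ := Set.not_subset.1 h
  refine ⟨u, fun t => ?_⟩
  rw [Module.Basis.coord_apply, Module.Basis.repr_self, Finsupp.single_eq_of_ne]
  exact fun h => hu ⟨t, h.symm⟩

theorem eq_of_mem_supportedOn [Finite κ] {q : κ → ι} (hq : Function.Injective q)
    {F G : MultilinearMap ℝ (fun _ : κ => V) ℝ} (hF : F ∈ supportedOn e q)
    (hG : G ∈ supportedOn e q) (h : ∀ σ : Equiv.Perm κ, F (e ∘ q ∘ σ) = G (e ∘ q ∘ σ)) : F = G := by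
  refine Module.Basis.ext_multilinear (fun _ => e) fun c => ?_
  by_cases hc : Set.range q ⊆ Set.range c
  · obtain ⟨σ, rfl⟩ := exists_perm_of_range_subset hq hc
    exact h σ
  · exact (hF c hc).trans (hG c hc).symm

theorem eq_or_eq_swap_comp [DecidableEq ι] {a b : ι} {c d : κ → ι} (hc : Function.Injective c)
    (hd : Function.Injective d) (h : ∀ t, d t = c t ∨ d t = Equiv.swap a b (c t)) :
    d = c ∨ d = Equiv.swap a b ∘ c := by
  by_contra! hne
  obtain ⟨⟨t, ht⟩, s, hs⟩ := hne.imp Function.ne_iff.1 Function.ne_iff.1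
  have hdt := (h t).resolve_left ht
  have hds := (h s).resolve_right hs
  rw [Function.comp_apply] at hs
  grind [Function.Injective]

variable [Finite κ] {B : LinearMap.BilinForm ℝ V}
  {N : Submodule ℝ (MultilinearMap ℝ (fun _ : κ => V) ℝ)}

theorem exists_oddPart (hsymm : B.IsSymm) (hB : B.Nondegenerate) (he : B.IsOrthoᵢ e)
    (hN : ∀ g ∈ orthogonalGroup B, ∀ F ∈ N, F.compLinearMap (fun _ => g.toLinearMap) ∈ N)
    {F : MultilinearMap ℝ (fun _ : κ => V) ℝ} (hF : F ∈ N) (p : ι) :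
    ∃ G ∈ N, ∀ c : κ → ι, (G (e ∘ c) ≠ 0 → F (e ∘ c) ≠ 0 ∧ p ∈ Set.range c) ∧
      (Function.Injective c → p ∈ Set.range c → G (e ∘ c) = F (e ∘ c)) := by
  classical
  cases nonempty_fintype κ
  obtain ⟨g, hg, g_apply⟩ := exists_signChange hsymm hB he p
  refine ⟨(1 / 2 : ℝ) • (F - F.compLinearMap fun _ => g.toLinearMap),
    N.smul_mem _ (N.sub_mem hF (hN g hg F hF)), fun c => ?_⟩
  have component : ((1 / 2 : ℝ) • (F - F.compLinearMap fun _ => g.toLinearMap)) (e ∘ c) =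
      1 / 2 * (1 - ∏ t, if c t = p then -1 else 1) * F (e ∘ c) := by
    have flip : F.compLinearMap (fun _ => g.toLinearMap) (e ∘ c) =
        (∏ t, if c t = p then -1 else 1) * F (e ∘ c) :=
      (congrArg F (funext fun t => g_apply (c t))).trans (F.map_smul_univ _ _)
    rw [smul_apply, sub_apply, flip, smul_eq_mul]
    ring
  rw [component]
  refine ⟨fun h => ⟨right_ne_zero_of_mul h, by_contra fun hp => h ?_⟩, ?_⟩
  · have : ∀ t, c t ≠ p := fun t ht => hp ⟨t, ht⟩
    simp [this]
  · rintro hc ⟨t, rfl⟩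
    simp only [hc.eq_iff, Finset.prod_ite_eq', Finset.mem_univ, if_true]
    ring

theorem exists_supportedOn (hsymm : B.IsSymm) (hB : B.Nondegenerate) (he : B.IsOrthoᵢ e)
    (hN : ∀ g ∈ orthogonalGroup B, ∀ F ∈ N, F.compLinearMap (fun _ => g.toLinearMap) ∈ N)
    {F : MultilinearMap ℝ (fun _ : κ => V) ℝ} (hF : F ∈ N) {q : κ → ι}
    (hq : Function.Injective q) :
    ∃ G ∈ N, G ∈ supportedOn e q ∧ ∀ σ : Equiv.Perm κ, G (e ∘ q ∘ σ) = F (e ∘ q ∘ σ) := by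
  classical
  cases nonempty_fintype κ
  have on_finset : ∀ s : Finset ι, ∃ G ∈ N, ∀ c : κ → ι,
      (G (e ∘ c) ≠ 0 → ↑s ⊆ Set.range c) ∧
      (Function.Injective c → ↑s ⊆ Set.range c → G (e ∘ c) = F (e ∘ c)) := fun s => by
    induction s using Finset.induction_on with
    | empty => exact ⟨F, hF, fun c => ⟨fun _ => by simp, fun _ _ => rfl⟩⟩
    | insert p s _ ih =>
      obtain ⟨G, hG, G_apply⟩ := ih
      obtain ⟨H, hH, H_apply⟩ := exists_oddPart hsymm hB he hN hG p
      simp only [Finset.coe_insert, Set.insert_subset_iff]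
      refine ⟨H, hH, fun c => ⟨fun h => ?_, fun hc h => ?_⟩⟩
      · obtain ⟨hGc, hp⟩ := (H_apply c).1 h
        exact ⟨hp, (G_apply c).1 hGc⟩
      · rw [(H_apply c).2 hc h.1, (G_apply c).2 hc h.2]
  obtain ⟨G, hG, G_apply⟩ := on_finset (Finset.univ.image q)
  simp only [Finset.coe_image, Finset.coe_univ, Set.image_univ] at G_apply
  exact ⟨G, hG, fun c hc => by_contra fun h => hc ((G_apply c).1 h), fun σ =>
    (G_apply (q ∘ σ)).2 (hq.comp σ.injective) (σ.surjective.range_comp q).ge⟩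

theorem exists_mixingReflection_repr [DecidableEq ι] (hsymm : B.IsSymm) (hB : B.Nondegenerate)
    (he : B.IsOrthoᵢ e) {a b : ι} (hab : a ≠ b) :
    ∃ g ∈ orthogonalGroup B, (∀ i, e.repr (g (e (Equiv.swap a b i))) i ≠ 0) ∧
      ∀ i j, e.repr (g (e i)) j ≠ 0 → j = i ∨ j = Equiv.swap a b i := by
  obtain ⟨g, hg, α, β, γ, δ, -, hβ, hγ, -, g_a, g_b, g_fix⟩ :=
    exists_mixingReflection hsymm hB he hab
  refine ⟨g, hg, fun i => ?_, fun i j => ?_⟩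
  · rcases eq_or_ne i a with rfl | hia
    · simpa [g_b, hab] using hγ
    · rcases eq_or_ne i b with rfl | hib
      · simpa [g_a, hab] using hβ
      · simp [Equiv.swap_apply_of_ne_of_ne hia hib, g_fix i hia hib]
  · rcases eq_or_ne i a with rfl | hia
    · simp only [g_a, map_add, map_smul, Module.Basis.repr_self, Finsupp.smul_single,
        Finsupp.add_apply, Finsupp.single_apply, Equiv.swap_apply_left]
      grind
    · rcases eq_or_ne i b with rfl | hib
      · simp only [g_b, map_add, map_smul, Module.Basis.repr_self, Finsupp.smul_single,
          Finsupp.add_apply, Finsupp.single_apply, Equiv.swap_apply_right]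
        grind
      · simp only [g_fix i hia hib, Module.Basis.repr_self, Finsupp.single_apply]
        grind

theorem exists_swap [Finite ι] [DecidableEq ι] (hsymm : B.IsSymm) (hB : B.Nondegenerate)
    (he : B.IsOrthoᵢ e)
    (hN : ∀ g ∈ orthogonalGroup B, ∀ F ∈ N, F.compLinearMap (fun _ => g.toLinearMap) ∈ N)
    {F : MultilinearMap ℝ (fun _ : κ => V) ℝ} (hF : F ∈ N) {q : κ → ι}
    (hq : Function.Injective q) {a b : ι} (hab : a ≠ b) :
    ∃ G ∈ N, ∀ σ : Equiv.Perm κ, G (e ∘ Equiv.swap a b ∘ q ∘ σ) = F (e ∘ q ∘ σ) := by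
  classical
  cases nonempty_fintype ι
  cases nonempty_fintype κ
  rcases eq_or_ne (Equiv.swap a b ∘ q) q with hfix | hmove
  · exact ⟨F, hF, fun σ => congrArg (fun c => F (e ∘ c ∘ σ)) hfix⟩
  obtain ⟨F, hF, hFq, F_apply⟩ := exists_supportedOn hsymm hB he hN hF hq
  obtain ⟨g, hg, repr_ne, repr_supp⟩ := exists_mixingReflection_repr hsymm hB he hab
  let l : ℝ := ∏ t, e.repr (g (e (Equiv.swap a b (q t)))) (Equiv.swap a b (q t))
  let μ : ℝ := ∏ t, e.repr (g (e (Equiv.swap a b (q t)))) (q t)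
  have hμ : μ ≠ 0 := Finset.prod_ne_zero_iff.2 fun t _ => repr_ne (q t)
  refine ⟨μ⁻¹ • (F.compLinearMap (fun _ => g.toLinearMap) - l • F),
    N.smul_mem _ (N.sub_mem (hN g hg F hF) (N.smul_mem _ hF)), fun σ => ?_⟩
  have component : F.compLinearMap (fun _ => g.toLinearMap) (e ∘ Equiv.swap a b ∘ q ∘ σ) =
      l * F (e ∘ Equiv.swap a b ∘ q ∘ σ) + μ * F (e ∘ q ∘ σ) := by
    rw [compLinearMap_apply_basis, Fintype.sum_eq_add (Equiv.swap a b ∘ q ∘ σ) (q ∘ σ)]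
    · congr 2
      · exact Equiv.prod_comp σ fun t =>
          e.repr (g (e (Equiv.swap a b (q t)))) (Equiv.swap a b (q t))
      · exact Equiv.prod_comp σ fun t => e.repr (g (e (Equiv.swap a b (q t)))) (q t)
    · exact fun h => hmove (σ.surjective.injective_comp_right h)
    · intro d hd
      by_contra! hterm
      obtain ⟨hcoeff, hFd⟩ := mul_ne_zero_iff.1 hterm
      obtain ⟨τ, rfl⟩ := exists_perm_of_range_subset hq (range_subset_of_mem_supportedOn hFq hFd)
      have swap_swap : Equiv.swap a b ∘ Equiv.swap a b ∘ q ∘ σ = q ∘ σ :=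
        funext fun t => Equiv.swap_apply_self _ _ _
      have d_eq := eq_or_eq_swap_comp ((Equiv.swap a b).injective.comp (hq.comp σ.injective))
        (hq.comp τ.injective)
        fun t => repr_supp _ _ (Finset.prod_ne_zero_iff.1 hcoeff t (Finset.mem_univ t))
      rw [swap_swap] at d_eq
      exact not_or.2 hd d_eq
  rw [smul_apply, sub_apply, component, smul_apply, smul_eq_mul, smul_eq_mul, add_sub_cancel_left,
    inv_mul_cancel_left₀ hμ, F_apply]

theorem exists_reindexed (hsymm : B.IsSymm) (hB : B.Nondegenerate) (he : B.IsOrthoᵢ e)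
    (hN : ∀ g ∈ orthogonalGroup B, ∀ F ∈ N, F.compLinearMap (fun _ => g.toLinearMap) ∈ N)
    [Finite ι] {F : MultilinearMap ℝ (fun _ : κ => V) ℝ} (hF : F ∈ N) {q q' : κ → ι}
    (hq : Function.Injective q) (hq' : Function.Injective q') :
    ∃ G ∈ N, G ∈ supportedOn e q' ∧ ∀ σ : Equiv.Perm κ, G (e ∘ q' ∘ σ) = F (e ∘ q ∘ σ) := by
  classical
  have by_perm : ∀ π : Equiv.Perm ι,
      ∃ G ∈ N, ∀ σ : Equiv.Perm κ, G (e ∘ π ∘ q ∘ σ) = F (e ∘ q ∘ σ) := fun π => by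
    induction π using Equiv.Perm.swap_induction_on with
    | one => exact ⟨F, hF, fun _ => rfl⟩
    | swap_mul π a b hab ih =>
      obtain ⟨G, hG, G_apply⟩ := ih
      obtain ⟨H, hH, H_apply⟩ := exists_swap hsymm hB he hN hG (π.injective.comp hq) hab
      exact ⟨H, hH, fun σ => (H_apply σ).trans (G_apply σ)⟩
  obtain ⟨π, hπ⟩ := Equiv.Perm.exists_extending_pair q q' hq hq'
  obtain ⟨G, hG, G_apply⟩ := by_perm π
  obtain ⟨H, hH, hHq', H_apply⟩ := exists_supportedOn hsymm hB he hN hG hq'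
  refine ⟨H, hH, hHq', fun σ => ?_⟩
  rw [H_apply, ← G_apply]
  exact congrArg (fun c => G (e ∘ c ∘ σ)) (funext hπ).symm

theorem multilinearForm_self_ne_zero [Fintype κ] [Fintype ι] [DecidableEq κ] (hB : B.Nondegenerate)
    (he : B.IsOrthoᵢ e) {q : κ → ι} (hq : Function.Injective q)
    {F : MultilinearMap ℝ (fun _ : κ => V) ℝ} (hFq : F ∈ supportedOn e q) {c : κ → ι}
    (hc : F (e ∘ c) ≠ 0) : multilinearForm κ B e F F ≠ 0 := by
  have factor : multilinearForm κ B e F F =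
      (∏ t, (B (e (q t)) (e (q t)))⁻¹) * ∑ d : κ → ι, F (e ∘ d) * F (e ∘ d) := by
    rw [multilinearForm_apply, Finset.mul_sum]
    refine Finset.sum_congr rfl fun d _ => ?_
    by_cases hd : F (e ∘ d) = 0
    · rw [hd, mul_zero, mul_zero, mul_zero]
    · obtain ⟨σ, rfl⟩ := exists_perm_of_range_subset hq (range_subset_of_mem_supportedOn hFq hd)
      congr 1
      exact Equiv.prod_comp σ fun t => (B (e (q t)) (e (q t)))⁻¹
  have sum_pos : 0 < ∑ d : κ → ι, F (e ∘ d) * F (e ∘ d) :=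
    Finset.sum_pos' (fun d _ => mul_self_nonneg _) ⟨c, Finset.mem_univ c, mul_self_pos.2 hc⟩
  rw [factor]
  exact mul_ne_zero (Finset.prod_ne_zero_iff.2 fun t _ =>
    inv_ne_zero (orthogonalBasis_apply_self_ne_zero hB he _)) sum_pos.ne'

end Relabelling

section EquivariantEmbedding

variable {V : Type*} [AddCommGroup V] [Module ℝ V] {B : LinearMap.BilinForm ℝ V} {ι κ X : Type*}
  {e : Module.Basis ι ℝ V} [Finite κ] [AddCommGroup X] [Module ℝ X]
  {ρ : Representation ℝ (orthogonalGroup B) X} {Φ : X →ₗ[ℝ] MultilinearMap ℝ (fun _ : κ => V) ℝ}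

theorem exists_reindexed_of_mem [Finite ι] (hsymm : B.IsSymm) (hB : B.Nondegenerate)
    (he : B.IsOrthoᵢ e)
    (hΦ : ∀ g x, Φ (ρ g x) = (Φ x).compLinearMap fun _ => (g⁻¹ : V ≃ₗ[ℝ] V).toLinearMap)
    (N : Subrepresentation ρ) {x : X} (hx : x ∈ N.toSubmodule) {q q' : κ → ι}
    (hq : Function.Injective q) (hq' : Function.Injective q') :
    ∃ y ∈ N.toSubmodule, Φ y ∈ supportedOn e q' ∧
      ∀ σ : Equiv.Perm κ, Φ y (e ∘ q' ∘ σ) = Φ x (e ∘ q ∘ σ) := by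
  have invariance : ∀ g ∈ orthogonalGroup B, ∀ F ∈ N.toSubmodule.map Φ,
      F.compLinearMap (fun _ => g.toLinearMap) ∈ N.toSubmodule.map Φ := by
    rintro g hg _ ⟨x, hx, rfl⟩
    refine ⟨ρ ⟨g, hg⟩⁻¹ x, N.apply_mem_toSubmodule _ hx, ?_⟩
    rw [hΦ]
    rfl
  obtain ⟨_, ⟨y, hy, rfl⟩, supp_y, y_apply⟩ :=
    exists_reindexed hsymm hB he invariance (Submodule.mem_map_of_mem hx) hq hq'
  exact ⟨y, hy, supp_y, y_apply⟩

theorem isIrreducible_of_supportedOn [FiniteDimensional ℝ V] [FiniteDimensional ℝ X]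
    (hsymm : B.IsSymm) (hB : B.Nondegenerate) (he : B.IsOrthoᵢ e)
    (hΦ : ∀ g x, Φ (ρ g x) = (Φ x).compLinearMap fun _ => (g⁻¹ : V ≃ₗ[ℝ] V).toLinearMap)
    (W : Subrepresentation ρ) {t : X} (htW : t ∈ W.toSubmodule) {q c : κ → ι}
    (hq : Function.Injective q) (supp_t : Φ t ∈ supportedOn e q) (hc : Φ t (e ∘ c) ≠ 0)
    (h : ∀ N : Subrepresentation ρ, N.toSubmodule ≤ W.toSubmodule → N.toSubmodule ≠ ⊥ →
      t ∈ N.toSubmodule) :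
    W.toRepresentation.IsIrreducible := by
  classical
  have := Module.Finite.finite_basis e
  cases nonempty_fintype ι
  cases nonempty_fintype κ
  refine isIrreducible_toRepresentation_of_forall_mem ((multilinearForm κ B e).compl₁₂ Φ Φ)
    (fun g x y => ?_) W t (multilinearForm_self_ne_zero hB he hq supp_t hc) htW h
  simp only [LinearMap.compl₁₂_apply, hΦ]
  exact multilinearForm_compLinearMap hsymm hB he (g⁻¹).2 (Φ x) (Φ y)

end EquivariantEmbedding

/-! ### Irreducibility -/

section TracelessForms

variable {V : Type*} [AddCommGroup V] [Module ℝ V] {B : LinearMap.BilinForm ℝ V}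
  {ι : Type*} {e : Module.Basis ι ℝ V}

theorem apply_self_mul_apply_self_of_offDiagonal (hsymm : B.IsSymm) (hB : B.Nondegenerate)
    (he : B.IsOrthoᵢ e) {φ : Tensor2 V} {s : Set ι}
    (hφ : ∀ g ∈ orthogonalGroup B, (∀ i ∈ s, g (e i) = e i) → ∀ i ∉ s, ∀ j ∉ s, i ≠ j →
      φ (g (e i)) (g (e j)) = 0) {i j : ι} (hi : i ∉ s) (hj : j ∉ s) :
    φ (e i) (e i) * B (e j) (e j) = φ (e j) (e j) * B (e i) (e i) := by
  rcases eq_or_ne i j with rfl | hij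
  · rfl
  obtain ⟨g, hg, α, β, γ, δ, hα, -, hγ, -, g_i, g_j, g_fix⟩ :=
    exists_mixingReflection hsymm hB he hij
  have offDiag : ∀ {k l}, k ∉ s → l ∉ s → k ≠ l → φ (e k) (e l) = 0 := fun hk hl hkl =>
    hφ 1 (one_mem _) (fun _ _ => rfl) _ hk _ hl hkl
  have hφij : α * γ * φ (e i) (e i) + β * δ * φ (e j) (e j) = 0 := by
    have h := hφ g hg (fun k hk => g_fix k (fun h => hi (h ▸ hk)) fun h => hj (h ▸ hk))
      i hi j hj hij
    simp only [g_i, g_j, map_add, map_smul, LinearMap.add_apply, LinearMap.smul_apply, smul_eq_mul,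
      offDiag hi hj hij, offDiag hj hi hij.symm] at h
    linear_combination h
  have hBij : α * γ * B (e i) (e i) + β * δ * B (e j) (e j) = 0 := by
    have h := (hg (e i) (e j)).trans (he hij)
    simp only [g_i, g_j, map_add, map_smul, LinearMap.add_apply, LinearMap.smul_apply, smul_eq_mul,
      show B (e i) (e j) = 0 from he hij, show B (e j) (e i) = 0 from he hij.symm] at h
    linear_combination h
  refine mul_left_cancel₀ (mul_ne_zero hα hγ) ?_
  linear_combination B (e j) (e j) * hφij - φ (e j) (e j) * hBij

theorem apply_self_eq_zero_of_offDiagonal [FiniteDimensional ℝ V] (hsymm : B.IsSymm)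
    (hB : B.Nondegenerate) (he : B.IsOrthoᵢ e) {φ : Tensor2 V} {s : Set ι}
    (hs : ∀ i ∈ s, φ (e i) (e i) = 0)
    (hφ : ∀ g ∈ orthogonalGroup B, (∀ i ∈ s, g (e i) = e i) → ∀ i ∉ s, ∀ j ∉ s, i ≠ j →
      φ (g (e i)) (g (e j)) = 0) (htr : metricTrace B hB φ = 0) (i : ι) :
    φ (e i) (e i) = 0 := by
  classical
  have := Module.Finite.finite_basis e
  cases nonempty_fintype ι
  by_cases hi : i ∈ s
  · exact hs i hi
  have e_ne := orthogonalBasis_apply_self_ne_zero hB he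
  have trace_eq : metricTrace B hB φ =
      ∑ j, if j ∉ s then (B (e i) (e i))⁻¹ * φ (e i) (e i) else 0 := by
    rw [metricTrace_eq_sum_orthogonal hB hsymm he]
    refine Finset.sum_congr rfl fun j _ => ?_
    split_ifs with hj
    · rw [hs j hj, mul_zero]
    · have := apply_self_mul_apply_self_of_offDiagonal hsymm hB he hφ hi hj
      field_simp [e_ne i, e_ne j]
      linear_combination -this
  rw [htr, ← Finset.sum_filter, Finset.sum_const, eq_comm, smul_eq_zero] at trace_eq
  exact (mul_eq_zero.1 (trace_eq.resolve_left
    (Finset.card_ne_zero_of_mem (Finset.mem_filter.2 ⟨Finset.mem_univ i, hi⟩)))).resolve_left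
    (inv_ne_zero (e_ne i))

end TracelessForms

section SymmetricForms

variable {V : Type*} [AddCommGroup V] [Module ℝ V] {B : LinearMap.BilinForm ℝ V}
  {ι : Type*} {e : Module.Basis ι ℝ V}

theorem exists_offDiagonal_apply_ne_zero [FiniteDimensional ℝ V] (hsymm : B.IsSymm)
    (hB : B.Nondegenerate) (he : B.IsOrthoᵢ e) {N : Subrepresentation (orep2 B)}
    (hN : N.toSubmodule ≤ (sym2Zero B hB).toSubmodule) (hN' : N.toSubmodule ≠ ⊥) :
    ∃ ψ ∈ N.toSubmodule,
      ∃ p : Fin 2 → ι, Function.Injective p ∧ multilinear2 V ψ (e ∘ p) ≠ 0 := by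
  obtain ⟨ψ, hψ, hψ0⟩ := N.toSubmodule.ne_bot_iff.1 hN'
  by_contra! vanish
  have offDiag : ∀ ψ ∈ N.toSubmodule, ∀ i j, i ≠ j → ψ (e i) (e j) = 0 := fun ψ hψ i j hij =>
    vanish ψ hψ ![i, j] (injective_pair_iff_ne.2 hij)
  refine hψ0 (e.ext fun i => e.ext fun j => ?_)
  rcases eq_or_ne i j with rfl | hij
  · exact apply_self_eq_zero_of_offDiagonal hsymm hB he (s := ∅) (by simp)
      (fun g hg _ p _ q _ hpq =>
        offDiag _ (N.apply_mem_toSubmodule (⟨g, hg⟩⁻¹ : orthogonalGroup B) hψ) p q hpq) (hN hψ).1 i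
  · exact offDiag ψ hψ i j hij

/-- The symmetric product `f ⊗ h + h ⊗ f` of two linear forms. -/
def symProd (f h : V →ₗ[ℝ] ℝ) : Tensor2 V :=
  f.smulRight h + h.smulRight f

theorem symProd_apply (f h : V →ₗ[ℝ] ℝ) (x y : V) : symProd f h x y = f x * h y + h x * f y :=
  rfl

theorem symProd_mem_sym2 (f h : V →ₗ[ℝ] ℝ) : symProd f h ∈ (sym2 V).toSubmodule := fun x y => by
  rw [symProd_apply, symProd_apply]
  ring

theorem symProd_coord_mem_supportedOn (e : Module.Basis ι ℝ V) (q : Fin 2 → ι) :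
    multilinear2 V (symProd (e.coord (q 0)) (e.coord (q 1))) ∈ supportedOn e q := fun c hc => by
  obtain ⟨u, hu⟩ := exists_coord_eq_zero (e := e) hc
  rw [multilinear2_apply, symProd_apply]
  fin_cases u <;> simp_all

theorem symProd_coord_mem_sym2Zero [FiniteDimensional ℝ V] (hsymm : B.IsSymm)
    (hB : B.Nondegenerate) (he : B.IsOrthoᵢ e) {q : Fin 2 → ι} (hq : Function.Injective q) :
    symProd (e.coord (q 0)) (e.coord (q 1)) ∈ (sym2Zero B hB).toSubmodule := by
  have := Module.Finite.finite_basis e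
  cases nonempty_fintype ι
  refine ⟨?_, symProd_mem_sym2 _ _⟩
  refine (metricTrace_eq_sum_orthogonal hB hsymm he _).trans (Finset.sum_eq_zero fun i _ => ?_)
  have repeated : ¬ Function.Injective fun _ : Fin 2 => i := fun h => zero_ne_one (@h 0 1 rfl)
  rw [show symProd _ _ (e i) (e i) = 0 from
    apply_eq_zero_of_not_injective hq (symProd_coord_mem_supportedOn e q) repeated, mul_zero]

theorem eq_smul_symProd_coord {q : Fin 2 → ι} (hq : Function.Injective q) {ψ : Tensor2 V}
    (hψ : ψ ∈ (sym2 V).toSubmodule) (supp : multilinear2 V ψ ∈ supportedOn e q) :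
    ψ = ψ (e (q 0)) (e (q 1)) • symProd (e.coord (q 0)) (e.coord (q 1)) := by
  refine (multilinear2 V).injective (eq_of_mem_supportedOn hq supp ?_ fun σ => ?_)
  · rw [map_smul]
    exact Submodule.smul_mem _ _ (symProd_coord_mem_supportedOn e q)
  · have q_ne : q 0 ≠ q 1 := hq.ne (by decide)
    have hσ : σ 0 = 0 ∧ σ 1 = 1 ∨ σ 0 = 1 ∧ σ 1 = 0 := by
      revert σ
      decide
    rcases hσ with ⟨h0, h1⟩ | ⟨h0, h1⟩
    · simp [multilinear2_apply, symProd_apply, h0, h1, q_ne]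
    · simp [multilinear2_apply, symProd_apply, h0, h1, q_ne, hψ (e (q 1)) (e (q 0))]

theorem isIrreducible_sym2Zero [FiniteDimensional ℝ V] (hm : 2 ≤ Module.finrank ℝ V)
    (hsymm : B.IsSymm) (hB : B.Nondegenerate) :
    (sym2Zero B hB).toRepresentation.IsIrreducible := by
  obtain ⟨e, he⟩ := exists_orthogonalBasis hsymm
  let q : Fin 2 → Fin (Module.finrank ℝ V) := Fin.castLE hm
  have hq : Function.Injective q := Fin.castLE_injective hm
  have component : multilinear2 V (symProd (e.coord (q 0)) (e.coord (q 1))) (e ∘ q) ≠ 0 := by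
    simp [multilinear2_apply, symProd_apply, hq.ne (show (0 : Fin 2) ≠ 1 by decide)]
  refine isIrreducible_of_supportedOn (Φ := (multilinear2 V).toLinearMap) hsymm hB he
    (fun _ _ => rfl) _ (symProd_coord_mem_sym2Zero hsymm hB he hq) hq
    (symProd_coord_mem_supportedOn e q) component fun N hN hN' => ?_
  obtain ⟨ψ, hψ, p, hp, ψ_apply⟩ := exists_offDiagonal_apply_ne_zero hsymm hB he hN hN'
  obtain ⟨φ, hφ, φ_supp, φ_apply⟩ := exists_reindexed_of_mem (Φ := (multilinear2 V).toLinearMap)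
    hsymm hB he (fun _ _ => rfl) N hψ hp hq
  have hφ0 : φ (e (q 0)) (e (q 1)) ≠ 0 := fun h => ψ_apply ((φ_apply 1).symm.trans h)
  have smul_mem := eq_smul_symProd_coord hq (hN hφ).2 φ_supp ▸ hφ
  exact (Submodule.smul_mem_iff _ hφ0).1 smul_mem

end SymmetricForms

section WeylTensors

variable {V : Type*} [AddCommGroup V] [Module ℝ V] {ι : Type*} {e : Module.Basis ι ℝ V}

theorem bianchi_last {R : Tensor4 V} (hR : R ∈ (algCurv V).toSubmodule) (x y z w : V) :
    R x y z w + R x z w y + R x w y z = 0 := by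
  obtain ⟨ha, hb, hc, -⟩ := hR
  linarith [hb y z w x, hc y z w x, ha w x y z, hc z w y x, ha y x z w, hc w y z x, ha z x w y]

theorem eq_zero_of_mem_supportedOn {q : Fin 4 → ι} (hq : Function.Injective q) {R : Tensor4 V}
    (hR : R ∈ (algCurv V).toSubmodule) (supp : multilinear4 V R ∈ supportedOn e q)
    (h0123 : R (e (q 0)) (e (q 1)) (e (q 2)) (e (q 3)) = 0)
    (h0231 : R (e (q 0)) (e (q 2)) (e (q 3)) (e (q 1)) = 0) : R = 0 := by
  have h0312 := bianchi_last hR (e (q 0)) (e (q 1)) (e (q 2)) (e (q 3))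
  rw [h0123, h0231, zero_add, zero_add] at h0312
  obtain ⟨ha, -, hc, hd⟩ := hR
  have zero_first : ∀ b c d : Fin 4, [0, b, c, d].Nodup →
      R (e (q 0)) (e (q b)) (e (q c)) (e (q d)) = 0 := fun b c d h => by
    have orders : (b, c, d) ∈
        [(1, 2, 3), (2, 3, 1), (3, 1, 2), (1, 3, 2), (2, 1, 3), (3, 2, 1)] := by
      revert b c d
      decide
    fin_cases orders <;> first | assumption | (rw [hd, neg_eq_zero]; assumption)
  have distinct : ∀ i j k l : Fin 4, [i, j, k, l].Nodup →
      R (e (q i)) (e (q j)) (e (q k)) (e (q l)) = 0 := fun i j k l h => by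
    have some_zero : i = 0 ∨ j = 0 ∨ k = 0 ∨ l = 0 := by
      revert i j k l
      decide
    rcases some_zero with rfl | rfl | rfl | rfl
    · exact zero_first j k l h
    · rw [ha, zero_first i k l (by simp_all; tauto), neg_zero]
    · rw [hc, zero_first l i j (by simp_all; tauto)]
    · rw [hc, ha, zero_first k i j (by simp_all; tauto), neg_zero]
  refine (multilinear4 V).injective (eq_of_mem_supportedOn hq supp ?_ fun σ => ?_)
  · rw [map_zero]
    exact zero_mem _
  · exact distinct _ _ _ _ (List.nodup_ofFn.2 σ.injective)

/-- The curvature tensor `(ξ⁰ ξ¹) ∧ (ξ² ξ³)`, where `ξᵗ` is the coordinate of index `q t`. -/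
def coordWedge (e : Module.Basis ι ℝ V) (q : Fin 4 → ι) : Tensor4 V :=
  wedge (symProd (e.coord (q 0)) (e.coord (q 1))) (symProd (e.coord (q 2)) (e.coord (q 3)))

theorem coordWedge_mem_algCurv (e : Module.Basis ι ℝ V) (q : Fin 4 → ι) :
    coordWedge e q ∈ (algCurv V).toSubmodule :=
  wedge_mem_algCurv (symProd_mem_sym2 _ _) (symProd_mem_sym2 _ _)

theorem coordWedge_mem_supportedOn (e : Module.Basis ι ℝ V) (q : Fin 4 → ι) :
    multilinear4 V (coordWedge e q) ∈ supportedOn e q := fun c hc => by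
  obtain ⟨u, hu⟩ := exists_coord_eq_zero (e := e) hc
  rw [multilinear4_apply, coordWedge, wedge_apply]
  simp only [symProd_apply, Function.comp_apply]
  fin_cases u <;> simp_all

theorem coordWedge_apply_0123 {q : Fin 4 → ι} (hq : Function.Injective q) :
    coordWedge e q (e (q 0)) (e (q 1)) (e (q 2)) (e (q 3)) = 0 := by
  simp [coordWedge, wedge_apply, symProd_apply, hq.eq_iff]

theorem coordWedge_apply_0231 {q : Fin 4 → ι} (hq : Function.Injective q) :
    coordWedge e q (e (q 0)) (e (q 2)) (e (q 3)) (e (q 1)) = 1 / 2 := by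
  simp [coordWedge, wedge_apply, symProd_apply, hq.eq_iff]

variable [FiniteDimensional ℝ V] {B : LinearMap.BilinForm ℝ V}

theorem coordWedge_mem_weyl (hsymm : B.IsSymm) (hB : B.Nondegenerate) (he : B.IsOrthoᵢ e)
    {q : Fin 4 → ι} (hq : Function.Injective q) : coordWedge e q ∈ (weyl B hB).toSubmodule := by
  have := Module.Finite.finite_basis e
  cases nonempty_fintype ι
  refine ⟨e.ext fun j => e.ext fun k => ?_, coordWedge_mem_algCurv e q⟩
  refine (rho14_eq_sum_orthogonal hB hsymm he _ _ _).trans (Finset.sum_eq_zero fun i _ => ?_)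
  have repeated : ¬ Function.Injective ![i, j, k, i] := fun h =>
    absurd (@h 0 3 rfl) (by decide)
  have vanish : multilinear4 V (coordWedge e q) (e ∘ ![i, j, k, i]) = 0 :=
    apply_eq_zero_of_not_injective hq (coordWedge_mem_supportedOn e q) repeated
  exact mul_eq_zero_of_right _ vanish

variable {N : Subrepresentation (orep4 B)}

theorem apply_outer_self_eq_zero (hsymm : B.IsSymm) (hB : B.Nondegenerate) (he : B.IsOrthoᵢ e)
    (hN : N.toSubmodule ≤ (weyl B hB).toSubmodule) {j k : ι}
    (h : ∀ R ∈ N.toSubmodule, ∀ i ∉ ({j, k} : Set ι), ∀ l ∉ ({j, k} : Set ι), i ≠ l →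
      R (e i) (e j) (e k) (e l) = 0) {R : Tensor4 V} (hR : R ∈ N.toSubmodule) (i : ι) :
    R (e i) (e j) (e k) (e i) = 0 := by
  obtain ⟨ricci, ha, -, -, hd⟩ := hN hR
  refine apply_self_eq_zero_of_offDiagonal (φ := (R.flip (e j)).flip (e k)) (s := {j, k})
    hsymm hB he ?_ (fun g hg g_fix i hi l hl hil => ?_) (LinearMap.congr_fun₂ ricci (e j) (e k)) i
  · rintro i (rfl | rfl)
    · exact self_eq_neg.1 (ha _ _ _ _)
    · exact self_eq_neg.1 (hd _ _ _ _)
  · have moved := h _ (N.apply_mem_toSubmodule (⟨g, hg⟩⁻¹ : orthogonalGroup B) hR) i hi l hl hil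
    change R (g (e i)) (g (e j)) (g (e k)) (g (e l)) = 0 at moved
    rwa [g_fix j (by simp), g_fix k (by simp)] at moved

theorem exists_distinct_apply_ne_zero (hsymm : B.IsSymm) (hB : B.Nondegenerate)
    (he : B.IsOrthoᵢ e) (hN : N.toSubmodule ≤ (weyl B hB).toSubmodule) (hN' : N.toSubmodule ≠ ⊥) :
    ∃ R ∈ N.toSubmodule, ∃ q : Fin 4 → ι, Function.Injective q ∧
      R (e (q 0)) (e (q 1)) (e (q 2)) (e (q 3)) ≠ 0 := by
  obtain ⟨R, hR, hR0⟩ := N.toSubmodule.ne_bot_iff.1 hN'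
  by_contra! vanish
  have distinct : ∀ R ∈ N.toSubmodule, ∀ i j k l, [i, j, k, l].Nodup →
      R (e i) (e j) (e k) (e l) = 0 := fun R hR i j k l h =>
    vanish R hR ![i, j, k, l] (List.nodup_ofFn.1 h)
  have outer_of_ne : ∀ R ∈ N.toSubmodule, ∀ i j k, j ≠ k → R (e i) (e j) (e k) (e i) = 0 :=
    fun R hR i j k hjk => apply_outer_self_eq_zero hsymm hB he hN
      (fun R hR i hi l hl hil => distinct R hR i j k l (by simp_all; tauto)) hR i
  have outer : ∀ i j k, R (e i) (e j) (e k) (e i) = 0 := fun i j k => by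
    rcases eq_or_ne j k with rfl | hjk
    · refine apply_outer_self_eq_zero hsymm hB he hN (fun R hR i _ l _ hil => ?_) hR i
      obtain ⟨-, ha, -, -, hd⟩ := hN hR
      rw [ha, hd, outer_of_ne R hR j i l hil, neg_zero, neg_zero]
    · exact outer_of_ne R hR i j k hjk
  obtain ⟨-, ha, -, -, hd⟩ := hN hR
  refine hR0 (e.ext fun i => e.ext fun j => e.ext fun k => e.ext fun l => ?_)
  change R (e i) (e j) (e k) (e l) = 0
  by_cases h : [i, j, k, l].Nodup
  · exact distinct R hR i j k l h
  · obtain rfl | rfl | rfl | rfl | rfl | rfl :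
        i = j ∨ k = l ∨ i = l ∨ i = k ∨ j = l ∨ j = k := by
      by_contra! hne
      exact h (by simp_all)
    · exact self_eq_neg.1 (ha _ _ _ _)
    · exact self_eq_neg.1 (hd _ _ _ _)
    · exact outer i j k
    · rw [hd, outer, neg_zero]
    · rw [ha, outer, neg_zero]
    · rw [ha, hd, outer, neg_zero, neg_zero]

theorem exists_distinct_apply_ne_apply (hsymm : B.IsSymm) (hB : B.Nondegenerate)
    (he : B.IsOrthoᵢ e) (hN : N.toSubmodule ≤ (weyl B hB).toSubmodule) (hN' : N.toSubmodule ≠ ⊥) :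
    ∃ R ∈ N.toSubmodule, ∃ q : Fin 4 → ι, Function.Injective q ∧
      R (e (q 0)) (e (q 2)) (e (q 3)) (e (q 1)) ≠ R (e (q 0)) (e (q 3)) (e (q 1)) (e (q 2)) := by
  obtain ⟨R, hR, q, hq, hX⟩ := exists_distinct_apply_ne_zero hsymm hB he hN hN'
  by_contra! cyclic
  have hYZ := cyclic R hR q hq
  have hZX : R (e (q 0)) (e (q 3)) (e (q 1)) (e (q 2)) =
      R (e (q 0)) (e (q 1)) (e (q 2)) (e (q 3)) :=
    cyclic R hR (q ∘ ![0, 2, 3, 1]) (hq.comp (by decide))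
  have := bianchi_last (hN hR).2 (e (q 0)) (e (q 1)) (e (q 2)) (e (q 3))
  exact hX (by linarith)

theorem coordWedge_mem (hsymm : B.IsSymm) (hB : B.Nondegenerate) (he : B.IsOrthoᵢ e)
    (hN : N.toSubmodule ≤ (weyl B hB).toSubmodule) (hN' : N.toSubmodule ≠ ⊥) {q : Fin 4 → ι}
    (hq : Function.Injective q) : coordWedge e q ∈ N.toSubmodule := by
  obtain ⟨R, hR, p, hp, hne⟩ := exists_distinct_apply_ne_apply hsymm hB he hN hN'
  set Y := R (e (p 0)) (e (p 2)) (e (p 3)) (e (p 1))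
  set Z := R (e (p 0)) (e (p 3)) (e (p 1)) (e (p 2)) with hZ
  have := Module.Finite.finite_basis e
  have reindexed := fun p hp => exists_reindexed_of_mem (Φ := (multilinear4 V).toLinearMap)
    (q := p) hsymm hB he (fun _ _ => rfl) N hR hp hq
  obtain ⟨S, hS, S_supp, S_apply⟩ := reindexed p hp
  -- Exchanging the last two labels turns the components `(X, Y, Z)` of `S` at the index orders
  -- `0123`, `0231`, `0312` into `(-X, -Z, -Y)`.
  obtain ⟨T, hT, T_supp, T_apply⟩ := reindexed (p ∘ Equiv.swap 2 3) (hp.comp (Equiv.injective _))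
  let cyc : Equiv.Perm (Fin 4) := Equiv.swap 1 2 * Equiv.swap 2 3
  have S_0123 : S (e (q 0)) (e (q 1)) (e (q 2)) (e (q 3)) =
      R (e (p 0)) (e (p 1)) (e (p 2)) (e (p 3)) := S_apply 1
  have S_0231 : S (e (q 0)) (e (q 2)) (e (q 3)) (e (q 1)) = Y := S_apply cyc
  have T_0123 : T (e (q 0)) (e (q 1)) (e (q 2)) (e (q 3)) =
      R (e (p 0)) (e (p 1)) (e (p 3)) (e (p 2)) := T_apply 1
  have T_0231 : T (e (q 0)) (e (q 2)) (e (q 3)) (e (q 1)) =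
      R (e (p 0)) (e (p 3)) (e (p 2)) (e (p 1)) := T_apply cyc
  have hd : AntisymmLast R := (hN hR).2.2.2.2
  have hST : S + T - (2 * (Y - Z)) • coordWedge e q = 0 := by
    refine eq_zero_of_mem_supportedOn hq (e := e) ?_ ?_ ?_ ?_
    · exact sub_mem (add_mem (hN hS).2 (hN hT).2)
        (Submodule.smul_mem _ _ (coordWedge_mem_algCurv e q))
    · rw [map_sub, map_add, map_smul]
      exact sub_mem (add_mem S_supp T_supp)
        (Submodule.smul_mem _ _ (coordWedge_mem_supportedOn e q))
    · simp only [LinearMap.sub_apply, LinearMap.add_apply, LinearMap.smul_apply,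
        coordWedge_apply_0123 hq, S_0123, T_0123, hd (e (p 0)) (e (p 1)) (e (p 2))]
      simp
    · simp only [LinearMap.sub_apply, LinearMap.add_apply, LinearMap.smul_apply, smul_eq_mul,
        coordWedge_apply_0231 hq, S_0231, T_0231, hd (e (p 0)) (e (p 3)) (e (p 2)), ← hZ]
      ring
  exact (Submodule.smul_mem_iff _ (mul_ne_zero two_ne_zero (sub_ne_zero.2 hne))).1
    (sub_eq_zero.1 hST ▸ add_mem hS hT)

theorem isIrreducible_weyl (hm : 4 ≤ Module.finrank ℝ V) (hsymm : B.IsSymm)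
    (hB : B.Nondegenerate) : (weyl B hB).toRepresentation.IsIrreducible := by
  obtain ⟨e, he⟩ := exists_orthogonalBasis hsymm
  have hq : Function.Injective (Fin.castLE hm) := Fin.castLE_injective hm
  have component : multilinear4 V (coordWedge e (Fin.castLE hm))
      (e ∘ Fin.castLE hm ∘ ![0, 2, 3, 1]) ≠ 0 :=
    (coordWedge_apply_0231 hq).trans_ne (by norm_num)
  exact isIrreducible_of_supportedOn (Φ := (multilinear4 V).toLinearMap) hsymm hB he
    (fun _ _ => rfl) _ (coordWedge_mem_weyl hsymm hB he hq) hq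
    (coordWedge_mem_supportedOn e _) component fun N hN hN' => coordWedge_mem hsymm hB he hN hN' hq

end WeylTensors

end AlgCurv

end

theorem theorem3p2 {V : Type*} [AddCommGroup V] [Module ℝ V] [FiniteDimensional ℝ V]
    (hm : 4 ≤ Module.finrank ℝ V)
    (B : LinearMap.BilinForm ℝ V) (hsymm : B.IsSymm) (hB : B.Nondegenerate) :
    -- (1)
    (∀ R : AlgCurv.Tensor4 V, AlgCurv.AntisymmFirst R → AlgCurv.Bianchi R →
      (AlgCurv.PairSymm R ↔ AlgCurv.AntisymmLast R)) ∧
    -- (2), the `GL(V)` equivariant sequence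
    (∃ (i : (AlgCurv.algCurv V).toRepresentation.IntertwiningMap
          (AlgCurv.curv V).toRepresentation)
        (p : (AlgCurv.curv V).toRepresentation.IntertwiningMap
          (AlgCurv.altSym V).toRepresentation)
        (s : (AlgCurv.altSym V).toRepresentation.IntertwiningMap
          (AlgCurv.curv V).toRepresentation),
      (∀ A, (i A : AlgCurv.Tensor4 V) = A) ∧
      (∀ R, (p R : AlgCurv.Tensor4 V) = AlgCurv.idSym (R : AlgCurv.Tensor4 V)) ∧
      (∀ S, (s S : AlgCurv.Tensor4 V) = AlgCurv.idSymSplit (S : AlgCurv.Tensor4 V)) ∧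
      AlgCurv.IsSplitShortExact i p s) ∧
    -- (2), the `O(V, B)` equivariant sequence
    (∃ (i : (AlgCurv.weyl B hB).toRepresentation.IntertwiningMap
          (AlgCurv.oAlgCurv B).toRepresentation)
        (p : (AlgCurv.oAlgCurv B).toRepresentation.IntertwiningMap
          (AlgCurv.oSym2 B).toRepresentation)
        (s : (AlgCurv.oSym2 B).toRepresentation.IntertwiningMap
          (AlgCurv.oAlgCurv B).toRepresentation),
      (∀ A, (i A : AlgCurv.Tensor4 V) = A) ∧
      (∀ A, (p A : AlgCurv.Tensor2 V) = AlgCurv.rho14 B hB (A : AlgCurv.Tensor4 V)) ∧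
      (∀ ψ, (s ψ : AlgCurv.Tensor4 V) = AlgCurv.rho14Split B hB (ψ : AlgCurv.Tensor2 V)) ∧
      AlgCurv.IsSplitShortExact i p s) ∧
    -- (3), the decomposition given by the second sequence and `S²(V*) = S₀²(V*, B) ⊕ ℝ B`
    (∃ e : Representation.Equiv
        ((AlgCurv.weyl B hB).toRepresentation.prod
          ((AlgCurv.sym2Zero B hB).toRepresentation.prod
            (Representation.trivial ℝ (AlgCurv.orthogonalGroup B) ℝ)))
        (AlgCurv.oAlgCurv B).toRepresentation,
      ∀ W ψ c, (e (W, ψ, c) : AlgCurv.Tensor4 V) =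
        (W : AlgCurv.Tensor4 V) + AlgCurv.rho14Split B hB ((ψ : AlgCurv.Tensor2 V) + c • B)) ∧
    (AlgCurv.weyl B hB).toRepresentation.IsIrreducible ∧
    (AlgCurv.sym2Zero B hB).toRepresentation.IsIrreducible ∧
    (Representation.trivial ℝ (AlgCurv.orthogonalGroup B) ℝ).IsIrreducible ∧
    -- the dimensions
    (Module.finrank ℝ (AlgCurv.weyl B hB).toSubmodule : ℚ) =
      1 / 12 * (Module.finrank ℝ V : ℚ) * ((Module.finrank ℝ V : ℚ) + 1) *
        ((Module.finrank ℝ V : ℚ) + 2) * ((Module.finrank ℝ V : ℚ) - 3) ∧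
    (Module.finrank ℝ (AlgCurv.sym2Zero B hB).toSubmodule : ℚ) =
      1 / 2 * ((Module.finrank ℝ V : ℚ) - 1) * ((Module.finrank ℝ V : ℚ) + 2) ∧
    Module.finrank ℝ ℝ = 1 ∧
    (Module.finrank ℝ (AlgCurv.algCurv V).toSubmodule : ℚ) =
      1 / 12 * (Module.finrank ℝ V : ℚ) ^ 2 * ((Module.finrank ℝ V : ℚ) ^ 2 - 1) := by
  have finrank_weyl := AlgCurv.finrank_algCurv_eq_add (by omega) hsymm hB
  have finrank_sym2Zero := AlgCurv.finrank_sym2_eq_add_one (by omega) hsymm hB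
  have algCurv_dim := AlgCurv.finrank_algCurv (V := V)
  have sym2_dim := AlgCurv.finrank_sym2 (V := V)
  rify at finrank_weyl finrank_sym2Zero
  refine ⟨fun R => AlgCurv.pairSymm_iff_antisymmLast,
    ⟨_, _, _, fun _ => rfl, fun _ => rfl, fun _ => rfl, AlgCurv.isSplitShortExact_curv⟩,
    ⟨_, _, _, fun _ => rfl, fun _ => rfl, fun _ => rfl,
      AlgCurv.isSplitShortExact_oAlgCurv (by omega) hsymm hB⟩,
    ⟨AlgCurv.curvatureDecomposition (by omega) hsymm hB,
      AlgCurv.curvatureDecomposition_apply _ hsymm hB⟩,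
    AlgCurv.isIrreducible_weyl hm hsymm hB, AlgCurv.isIrreducible_sym2Zero (by omega) hsymm hB,
    AlgCurv.isIrreducible_of_finrank_eq_one (Module.finrank_self ℝ), ?_, ?_,
    Module.finrank_self ℝ, ?_⟩ <;>
    apply Rat.cast_injective (α := ℝ) <;> push_cast
  · linear_combination algCurv_dim - sym2_dim - finrank_weyl
  · linear_combination sym2_dim - finrank_sym2Zero
  · exact algCurv_dim
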